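/- **Theorem 1.1.** For a commutative unital ring $K$ let $\mathcal H(K)$ be the multiplicative group of power series $1+a_1x+a_2x^2+\cdots\in K[[x]]$, and let $\mathcal N(K)$ be the Nottingham group, i.e. the set of power series $x+a_2x^2+a_3x^3+\cdots\in K[[x]]$ with the operation of substitution $(g\circ h)(x)=g(h(x))$. The Riordan group $\mathcal R(K)=\mathcal H(K)\rtimes\mathcal N(K)$ is the set $\mathcal H(K)\times\mathcal N(K)$ with the product $$(h_1,g_1)(h_2,g_2)=\bigl(h_1\cdot h_2(g_1),\; g_2(g_1)\bigr).$$ All these groups carry the topology of coefficientwise convergence with $K$ discrete; for $\mathcal R(K)$ this is the topology of the inverse limit of the discrete groups $\mathcal R(K)/\mathcal R^n(K)$, where $\mathcal R^n(K)=\{(h,g): h\equiv 1 \bmod x^n,\ g\equiv x \bmod x^{n+1}\}$. A profinite (pro-$p$) group is an inverse limit, over a directed set, of finite discrete groups (of finite discrete groups of $p$-power order). A subset $S$ of a topological group $G$ topologically generates $G$ if the subgroup generated by $S$ is dense in $G$, and $G$ is topologically finitely generated if some finite subset topologically generates it. Let $\gamma_1(G)=G$ and $\gamma_{n+1}(G)=[G,\gamma_n(G)]$.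 An infinite pro-$p$ group $G$ has finite width if $\sup_{n\ge 1}\log_p|\gamma_n(G)/\gamma_{n+1}(G)|<\infty$. Let $K$ be a finite commutative unital ring, let $p\ge 2$ be a prime number, let $\mathbb F_p=\mathbb Z/p\mathbb Z$, and let $\mathbb F_q$ be a finite field with $q$ elements and of characteristic $p$. Then: 1. $\mathcal R(K)$ is profinite; 2. $\mathcal R(\mathbb F_q)$ is a pro-$p$ group; 3. $\mathcal R(\mathbb F_p)$ and $\mathcal R(\mathbb Z)$ are topologically finitely generated; furthermore, for every subset $S_N$ that topologically generates $\mathcal N(\mathbb F_p)$ (respectively $\mathcal N(\mathbb Z)$), the set $\{(1+x,x)\}\cup\{(1,g):g\in S_N\}$ topologically generates $\mathcal R(\mathbb F_p)$ (respectively $\mathcal R(\mathbb Z)$); 4. $\mathcal R(\mathbb F_q)$ is infinite and has finite width; if moreover $p>2$, then $|\gamma_n(\mathcal R(\mathbb F_q))/\gamma_{n+1}(\mathcal R(\mathbb F_q))|\le q^4$ for every $n\ge 1$. -/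

import Mathlib

open PowerSeries

universe u v

namespace RiordanGroup

/-! ### The group of power series with constant term one, and the Nottingham group -/

/-- The set of formal power series `1 + a₁ x + a₂ x² + ⋯` over `K`. -/
@[ext]
structure HSeries (K : Type u) [CommRing K] where
  /-- the underlying power series -/
  ser : K⟦X⟧
  constCoeff_ser : constantCoeff ser = 1

/-- The set of formal power series `x + a₂ x² + a₃ x³ + ⋯` over `K`. -/
@[ext]
structure Nottingham (K : Type u) [CommRing K] where
  /-- the underlying power series -/
  ser : K⟦X⟧
  constCoeff_ser : constantCoeff ser = 0
  coeff_one_ser : coeff 1 ser = 1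

section

variable {K : Type u} [CommRing K]

theorem Nottingham.hasSubst (g : Nottingham K) : HasSubst g.ser :=
  HasSubst.of_constantCoeff_zero' g.constCoeff_ser

theorem Nottingham.isUnit_coeff_one (g : Nottingham K) : IsUnit (coeff 1 g.ser) := by
  rw [g.coeff_one_ser]; exact isUnit_one

theorem constantCoeff_subst_nottingham (f : K⟦X⟧) (g : Nottingham K) :
    constantCoeff (f.subst g.ser) = constantCoeff f := by
  have h1 : f = C (constantCoeff f) + (f - C (constantCoeff f)) := by ring
  have h2 : constantCoeff (f - C (constantCoeff f)) = 0 := by simp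
  have h3 : constantCoeff ((f - C (constantCoeff f)).subst g.ser) = 0 :=
    constantCoeff_subst_eq_zero g.constCoeff_ser _ h2
  rw [subst_sub g.hasSubst, map_sub, subst_C] at h3
  have h4 : constantCoeff (MvPowerSeries.C (constantCoeff f) : K⟦X⟧) = constantCoeff f := by
    exact MvPowerSeries.constantCoeff_C _
  rw [h4] at h3
  exact sub_eq_zero.mp h3

theorem coeff_one_subst_nottingham (f : K⟦X⟧) (g : Nottingham K) :
    coeff 1 (f.subst g.ser) = coeff 1 f := by
  rw [coeff_subst' g.hasSubst, finsum_eq_single _ 1]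
  · simp [g.coeff_one_ser]
  · intro n hn
    rcases Nat.lt_or_gt_of_ne hn with h | h
    · obtain rfl : n = 0 := by omega
      simp [coeff_one]
    · have hX : (X : K⟦X⟧) ∣ g.ser := X_dvd_iff.mpr g.constCoeff_ser
      have h0 : coeff 1 (g.ser ^ n) = 0 := X_pow_dvd_iff.mp (pow_dvd_pow_of_dvd hX n) 1 h
      rw [h0, smul_zero]

/-- `H(K)` is a group under multiplication of power series. -/
noncomputable instance : CommGroup (HSeries K) where
  mul h k := ⟨h.ser * k.ser, by rw [map_mul, h.constCoeff_ser, k.constCoeff_ser, one_mul]⟩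
  one := ⟨1, map_one _⟩
  inv h := ⟨invOfUnit h.ser 1, by simp⟩
  mul_assoc a b c := HSeries.ext (mul_assoc a.ser b.ser c.ser)
  one_mul a := HSeries.ext (one_mul a.ser)
  mul_one a := HSeries.ext (mul_one a.ser)
  inv_mul_cancel a := HSeries.ext (invOfUnit_mul a.ser 1 (by simpa using a.constCoeff_ser))
  mul_comm a b := HSeries.ext (mul_comm a.ser b.ser)

/-- `N(K)` is a group under substitution, `g * h = g ∘ h = g(h(x))`.
(`f.subst a` is the power series `f(a)`.) -/
noncomputable instance : Group (Nottingham K) where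
  mul g h := ⟨g.ser.subst h.ser,
    by rw [constantCoeff_subst_nottingham, g.constCoeff_ser],
    by rw [coeff_one_subst_nottingham, g.coeff_one_ser]⟩
  one := ⟨X, constantCoeff_X, coeff_one_X⟩
  inv g := ⟨g.ser.substInvOfIsUnit g.isUnit_coeff_one, by simp, by
    have h := (g.isUnit_coeff_one).unit.inv_mul
    rw [IsUnit.unit_spec] at h
    rw [coeff_one_substInvOfIsUnit]
    have h2 := mul_one (((g.isUnit_coeff_one).unit⁻¹ : Kˣ) : K)
    exact h2.symm.trans ((congrArg _ g.coeff_one_ser.symm).trans h)⟩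
  mul_assoc a b c := Nottingham.ext (subst_comp_subst_apply b.hasSubst c.hasSubst a.ser)
  one_mul a := Nottingham.ext (subst_X a.hasSubst)
  mul_one a := Nottingham.ext (X_subst a.ser)
  inv_mul_cancel a :=
    Nottingham.ext (subst_substInvOfIsUnit_left a.ser a.constCoeff_ser a.isUnit_coeff_one)

theorem HSeries.ser_mul (h k : HSeries K) : (h * k).ser = h.ser * k.ser := rfl

theorem HSeries.ser_one : (1 : HSeries K).ser = 1 := rfl

theorem Nottingham.ser_mul (g h : Nottingham K) : (g * h).ser = g.ser.subst h.ser := rfl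

theorem Nottingham.ser_one : (1 : Nottingham K).ser = X := rfl

/-- The substitution `h ∘ g = h(g(x))` of `g ∈ N(K)` into `h ∈ H(K)`. -/
noncomputable def HSeries.comp (h : HSeries K) (g : Nottingham K) : HSeries K :=
  ⟨h.ser.subst g.ser, by rw [constantCoeff_subst_nottingham, h.constCoeff_ser]⟩

theorem HSeries.comp_comp (h : HSeries K) (g k : Nottingham K) :
    (h.comp g).comp k = h.comp (g * k) :=
  HSeries.ext (subst_comp_subst_apply g.hasSubst k.hasSubst h.ser)

theorem HSeries.comp_one (h : HSeries K) : h.comp 1 = h := HSeries.ext (X_subst h.ser)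

theorem HSeries.mul_comp (h k : HSeries K) (g : Nottingham K) :
    (h * k).comp g = h.comp g * k.comp g :=
  HSeries.ext (subst_mul g.hasSubst h.ser k.ser)

variable (K) in
/-- The action of `N(K)` on `H(K)` by substitution, `φ(g)(h) = h ∘ g`. Since
`(h ∘ g) ∘ k = h ∘ (g ∘ k)`, it is a homomorphism on the opposite of the group `(N(K), ∘)`. -/
noncomputable def substAction : (Nottingham K)ᵐᵒᵖ →* MulAut (HSeries K) where
  toFun g :=
    { toFun := fun h => h.comp g.unop
      invFun := fun h => h.comp g.unop⁻¹
      left_inv := fun h => by beta_reduce; rw [HSeries.comp_comp, mul_inv_cancel, HSeries.comp_one]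
      right_inv := fun h => by beta_reduce; rw [HSeries.comp_comp, inv_mul_cancel, HSeries.comp_one]
      map_mul' := fun h k => HSeries.mul_comp h k g.unop }
  map_one' := MulEquiv.ext fun h => HSeries.comp_one h
  map_mul' g k := MulEquiv.ext fun h => (HSeries.comp_comp h k.unop g.unop).symm

end

/-! ### The Riordan group -/

/-- The Riordan group `R(K) = H(K) ⋊ N(K)`: the pairs `(h, g)` with `h ∈ H(K)`, `g ∈ N(K)` and
the product `(h₁, g₁) (h₂, g₂) = (h₁ · h₂(g₁), g₂(g₁))`, see `Riordan.mk_mul_mk`. -/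
abbrev Riordan (K : Type u) [CommRing K] : Type u :=
  HSeries K ⋊[substAction K] (Nottingham K)ᵐᵒᵖ

/-- The element `(h, g)` of the Riordan group. -/
def Riordan.mk {K : Type u} [CommRing K] (h : HSeries K) (g : Nottingham K) : Riordan K :=
  ⟨h, MulOpposite.op g⟩

theorem Riordan.mk_mul_mk {K : Type u} [CommRing K] (h₁ h₂ : HSeries K) (g₁ g₂ : Nottingham K) :
    Riordan.mk h₁ g₁ * Riordan.mk h₂ g₂ = Riordan.mk (h₁ * h₂.comp g₁) (g₂ * g₁) := rfl

/-! ### Topologies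

Each of `H(K)`, `N(K)`, `R(K)` carries the topology of coefficientwise convergence, where the
ring `K` of coefficients is discrete. Two elements of `R(K)` have the same image in
`R(K) / R^n(K)`, where `R^n(K)` consists of the `(h, g)` with `h ≡ 1 mod x^n` and
`g ≡ x mod x^(n+1)`, iff their first components agree modulo `x^n` and their second components
modulo `x^(n+1)`. So this is the topology of `R(K)` as the inverse limit of the discrete groups
`R(K) / R^n(K)`; likewise for `N(K)`. -/

/-- The topology of coefficientwise convergence on power series, with discrete coefficients. -/
noncomputable abbrev coeffTopology (K : Type u) [CommRing K] : TopologicalSpace K⟦X⟧ :=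
  TopologicalSpace.induced (fun (f : K⟦X⟧) (n : ℕ) => coeff n f)
    (@Pi.topologicalSpace ℕ (fun _ => K) (fun _ => ⊥))

noncomputable instance (K : Type u) [CommRing K] : TopologicalSpace (HSeries K) :=
  TopologicalSpace.induced HSeries.ser (coeffTopology K)

noncomputable instance (K : Type u) [CommRing K] : TopologicalSpace (Nottingham K) :=
  TopologicalSpace.induced Nottingham.ser (coeffTopology K)

noncomputable instance (K : Type u) [CommRing K] : TopologicalSpace (Riordan K) :=
  TopologicalSpace.induced (fun r : Riordan K => (r.left, r.right.unop)) inferInstance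

/-! ### Inverse limits, profinite groups and pro-`p` groups -/

/-- An inverse system of groups, indexed by a partially ordered set `I`. The groups are understood
to carry the discrete topology, so that all the maps are continuous. -/
structure InvSystem (I : Type u) [PartialOrder I] where
  /-- the groups of the system -/
  obj : I → Type v
  [grp : ∀ i, Group (obj i)]
  /-- the transition homomorphisms -/
  map : ∀ {i j : I}, i ≤ j → obj j →* obj i
  map_self : ∀ (i : I) (x : obj i), map (le_refl i) x = x
  map_map : ∀ {i j k : I} (hij : i ≤ j) (hjk : j ≤ k) (x : obj k),
    map hij (map hjk x) = map (hij.trans hjk) x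

attribute [instance] InvSystem.grp

/-- The inverse limit: the group of compatible families in the product of the groups. -/
def InvSystem.limit {I : Type u} [PartialOrder I] (D : InvSystem.{u, v} I) :
    Subgroup (∀ i, D.obj i) where
  carrier := {x | ∀ (i j : I) (hij : i ≤ j), D.map hij (x j) = x i}
  mul_mem' := fun {x y} hx hy i j hij => by
    rw [Pi.mul_apply, map_mul, hx i j hij, hy i j hij, Pi.mul_apply]
  one_mem' := fun i j hij => by rw [Pi.one_apply, map_one, Pi.one_apply]
  inv_mem' := fun {x} hx i j hij => by
    rw [Pi.inv_apply, map_inv, hx i j hij, Pi.inv_apply]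

/-- The topology of the inverse limit: induced by the product of the discrete topologies. -/
instance {I : Type u} [PartialOrder I] (D : InvSystem.{u, v} I) :
    TopologicalSpace D.limit :=
  TopologicalSpace.induced (fun x : D.limit => (x : ∀ i, D.obj i))
    (@Pi.topologicalSpace I D.obj (fun _ => ⊥))

/-- A topological group is pro-`𝒞`, for a class `𝒞` of groups, if it is isomorphic, as a
topological group, to the inverse limit of an inverse system of (discrete) `𝒞`-groups over a
directed set. -/
def IsPro (𝒞 : ∀ (H : Type u) [Group H], Prop) (G : Type u) [Group G] [TopologicalSpace G] :
    Prop :=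
  ∃ (I : Type u) (_ : PartialOrder I) (_ : Nonempty I) (_ : IsDirectedOrder I)
    (D : InvSystem.{u, u} I), (∀ i, 𝒞 (D.obj i)) ∧ Nonempty (G ≃ₜ* D.limit)

/-- Profinite groups: inverse limits of finite discrete groups. -/
def IsProfinite (G : Type u) [Group G] [TopologicalSpace G] : Prop :=
  IsPro (fun H _ => Finite H) G

/-- Pro-`p` groups: inverse limits of finite discrete `p`-groups, that is, of finite groups whose
order is a power of `p`. -/
def IsProP (p : ℕ) (G : Type u) [Group G] [TopologicalSpace G] : Prop :=
  IsPro (fun H _ => Finite H ∧ ∃ k : ℕ, Nat.card H = p ^ k) G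

/-! ### Topological generation -/

/-- `S` topologically generates `G`: the subgroup generated by `S` is dense in `G`. -/
def TopGenerates {G : Type u} [Group G] [TopologicalSpace G] (S : Set G) : Prop :=
  Dense (Subgroup.closure S : Set G)

/-- `G` is topologically finitely generated. -/
def IsTopFinGen (G : Type u) [Group G] [TopologicalSpace G] : Prop :=
  ∃ S : Set G, S.Finite ∧ TopGenerates S

/-- The power series `1 + x`, as an element of `H(K)`. -/
noncomputable def onePlusX (K : Type u) [CommRing K] : HSeries K :=
  ⟨1 + X, by rw [map_add, map_one, constantCoeff_X, add_zero]⟩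

/-- The set `{(1 + x, x)} ∪ {(1, g) : g ∈ S}`. Here `1 : Nottingham K` is the series `x`, and
`1 : HSeries K` is the series `1`. -/
def riordanSet {K : Type u} [CommRing K] (S : Set (Nottingham K)) : Set (Riordan K) :=
  {Riordan.mk (onePlusX K) 1} ∪ {r | ∃ g ∈ S, r = Riordan.mk 1 g}

/-! ### Lower central series and finite width -/

/-- The lower central series `γ₁(G) = G`, `γ_{n+1}(G) = [γ_n(G), G]` of (abstract) commutator
subgroups. Only the values at `n ≥ 1` matter. -/
def gamma (G : Type u) [Group G] (n : ℕ) : Subgroup G :=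
  (⊤ : Subgroup G).lowerCentralSeries (n - 1)

/-- The order `|γ_n(G) / γ_{n+1}(G)|`, a natural number or infinity. -/
noncomputable def gammaIndex (G : Type u) [Group G] (n : ℕ) : ℕ∞ :=
  ENat.card (gamma G n ⧸ (gamma G (n + 1)).subgroupOf (gamma G n))

/-- `G` is an infinite pro-`p` group of finite width: the numbers
`log_p |γ_n(G) / γ_{n+1}(G)|`, `n ≥ 1`, are bounded. -/
def HasFiniteWidth (p : ℕ) (G : Type u) [Group G] [TopologicalSpace G] : Prop :=
  Infinite G ∧ IsProP p G ∧ ∃ b : ℕ, ∀ n : ℕ, 1 ≤ n → gammaIndex G n ≤ (p : ℕ∞) ^ b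

end RiordanGroup

open RiordanGroup

open scoped commutatorElement


namespace RiordanGroup

/-! ### Leading terms of substitutions. -/

section Series

variable {K : Type u} [CommRing K]

/-! Everything is read off leading terms along the filtration R^n(K). The group R(K) is separated
and complete for it and carries its topology (`Riordan.isFiltration`), hence is the inverse limit of
its quotients by the R^n(K), which are finite when K is. In characteristic p, raising to the p-th
power multiplies leading coefficients by p = 0, so it maps R^n to R^(n+1) for n ≥ 1 and the
quotients are p-groups.

Generation. Conjugating (1 + x, x) by (1, g) gives (1 + g, x), and these elements generate H(K)
whenever ℤ → K is onto; this reduces R(K) to N(K). The group N(K) is topologically generated by x +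
x^2, …, x + x^8: from depth 8 on, every integer is a leading coefficient of an element of [N, N]
(`Nottingham.leads_commutator`), and commutators modulo the next depth can be computed from
approximations in the given subgroup (`commutator_le_of_central`). Commutators with x + x^2 and x +
x^3 have leading coefficients 2 - m and 4 - m in depth m. These suffice for m odd; for m even the
missing odd coefficient comes from a product of two commutators whose first two terms cancel
(`Nottingham.exists_odd_hasLead`).

Width. The γ_n are abstract commutator subgroups. To show that they contain open subgroups,
compactness is used: an equation z = ⁅f₀, a⁆ ⁅f₁, b⁆ that can be solved by successive approximation
has an exact solution (`IsFiltration.exists_eq`, `Nottingham.le_commutator`).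

For p odd, commutation with depth r has the leading factor 1 - r, and h(f)/h for h of level s has
the factor s. On γ_n one has s = r - 1 (apart from the start), so both filtrations skip a step at
the same time, each γ_n is known exactly, and each quotient has at most q^2 · q^2 elements.

For p = 2 the depth filtration is too coarse, since the derivative also matters: only even exponents
occur in low degree. The subgroups `Nottingham.gammaTwo` record g modulo x^(2k) and g' modulo
x^(4k-4); with the even levels of H they enclose γ_n between consecutive terms of one explicit
chain, which bounds the index by q^16. -/

theorem X_pow_dvd_derivative {n : ℕ} {u : K⟦X⟧} (h : (X : K⟦X⟧) ^ (n + 1) ∣ u) :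
    (X : K⟦X⟧) ^ n ∣ d⁄dX K u := by
  rw [X_pow_dvd_iff] at h ⊢
  intro m hm
  rw [coeff_derivative, h (m + 1) (by omega), zero_mul]

theorem X_pow_dvd_subst {n : ℕ} {u g : K⟦X⟧} (hg : constantCoeff g = 0)
    (h : (X : K⟦X⟧) ^ n ∣ u) : (X : K⟦X⟧) ^ n ∣ u.subst g := by
  obtain ⟨q, rfl⟩ := h
  have hs := HasSubst.of_constantCoeff_zero' hg
  rw [subst_mul hs, subst_pow hs, subst_X hs]
  exact Dvd.dvd.mul_right (pow_dvd_pow_of_dvd (X_dvd_iff.mpr hg) n) _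

theorem X_pow_dvd_of_le {m n : ℕ} (h : m ≤ n) {u : K⟦X⟧} (hu : (X : K⟦X⟧) ^ n ∣ u) :
    (X : K⟦X⟧) ^ m ∣ u := (pow_dvd_pow _ h).trans hu

/-- Taylor expansion to first order of a substitution. -/
theorem taylor_subst {a : ℕ} (ha : 1 ≤ a) (f : K⟦X⟧) {w y : K⟦X⟧} (hw : constantCoeff w = 0)
    (hy : (X : K⟦X⟧) ^ a ∣ y) :
    (X : K⟦X⟧) ^ (2 * a) ∣ f.subst (w + y) - f.subst w - (d⁄dX K f).subst w * y := by
  have hy0 : constantCoeff y = 0 := X_dvd_iff.mp ((dvd_pow_self _ (by omega)).trans hy)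
  have hwy : constantCoeff (w + y) = 0 := by rw [map_add, hw, hy0, add_zero]
  have hs := HasSubst.of_constantCoeff_zero' hw
  have hs' := HasSubst.of_constantCoeff_zero' hwy
  -- Split f into a polynomial, for which the binomial expansion holds exactly, and a tail q of
  -- order 2a + 1. The extra 1 is lost when q is differentiated.
  have hf := eq_shift_mul_X_pow_add_trunc (2 * a + 1) f
  set P := trunc (2 * a + 1) f with hP
  set q := (PowerSeries.mk fun i ↦ coeff (i + (2 * a + 1)) f) * (X : K⟦X⟧) ^ (2 * a + 1) with hq
  have hqd : (X : K⟦X⟧) ^ (2 * a + 1) ∣ q := Dvd.intro_left _ rfl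
  have h1 : (X : K⟦X⟧) ^ (2 * a) ∣ q.subst (w + y) :=
    X_pow_dvd_subst hwy (X_pow_dvd_of_le (by omega) hqd)
  have h2 : (X : K⟦X⟧) ^ (2 * a) ∣ q.subst w :=
    X_pow_dvd_subst hw (X_pow_dvd_of_le (by omega) hqd)
  have h3 : (X : K⟦X⟧) ^ (2 * a) ∣ (d⁄dX K q).subst w :=
    X_pow_dvd_subst hw (X_pow_dvd_derivative hqd)
  obtain ⟨k, hk⟩ := (P.map (algebraMap K K⟦X⟧)).binomExpansion w y
  rw [Polynomial.derivative_map] at hk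
  simp only [Polynomial.eval_map_algebraMap] at hk
  rw [hf, map_add, subst_add hs', subst_add hs, subst_add hs, derivative_coe, subst_coe hs',
    subst_coe hs, subst_coe hs, hk]
  have h4 : (X : K⟦X⟧) ^ (2 * a) ∣ y ^ 2 := by
    rw [mul_comm, pow_mul]; exact pow_dvd_pow_of_dvd hy 2
  have : q.subst (w + y) + ((Polynomial.aeval w) P + (Polynomial.aeval w) P.derivative * y +
      k * y ^ 2) - (q.subst w + (Polynomial.aeval w) P) -
      ((d⁄dX K q).subst w + (Polynomial.aeval w) P.derivative) * y =
      q.subst (w + y) - q.subst w - (d⁄dX K q).subst w * y + k * y ^ 2 := by ring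
  rw [this]
  exact dvd_add (dvd_sub (dvd_sub h1 h2) (h3.mul_right _)) (h4.mul_left _)

theorem X_pow_dvd_subst_sub_subst {a : ℕ} (f : K⟦X⟧) {w w' : K⟦X⟧} (hw : constantCoeff w = 0)
    (h : (X : K⟦X⟧) ^ a ∣ w' - w) :
    (X : K⟦X⟧) ^ a ∣ f.subst w' - f.subst w := by
  rcases Nat.eq_zero_or_pos a with rfl | ha
  · simp
  have := taylor_subst ha f hw h
  rw [add_sub_cancel] at this
  have h2 := (X_pow_dvd_of_le (by omega : a ≤ 2 * a) this).add
    (h.mul_left ((d⁄dX K f).subst w))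
  simpa using h2

theorem Nottingham.X_sq_dvd (f : Nottingham K) : (X : K⟦X⟧) ^ 2 ∣ f.ser - X := by
  rw [X_pow_dvd_iff]
  intro m hm
  interval_cases m
  · simp [f.constCoeff_ser]
  · simp [f.coeff_one_ser]

theorem Nottingham.X_cube_dvd (f : Nottingham K) :
    (X : K⟦X⟧) ^ 3 ∣ f.ser - X - C (coeff 2 f.ser) * X ^ 2 := by
  rw [X_pow_dvd_iff]
  intro m hm
  interval_cases m
  · simp [f.constCoeff_ser]
  · simp [f.coeff_one_ser, coeff_X_pow]
  · simp [coeff_X, coeff_X_pow]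

/-- `(x + c x² + ⋯)^s = x^s + s c x^(s+1) + ⋯`, and the same for any series of order `s`. -/
theorem X_pow_dvd_subst_sub {s : ℕ} (f : Nottingham K) {w : K⟦X⟧} (hw : (X : K⟦X⟧) ^ s ∣ w) :
    (X : K⟦X⟧) ^ (s + 2) ∣ w.subst f.ser - w - C ((s : K) * coeff 2 f.ser) * X * w := by
  obtain ⟨q, rfl⟩ := hw
  have hs := f.hasSubst
  rw [subst_mul hs, subst_pow hs, subst_X hs]
  obtain ⟨e, he⟩ := f.X_cube_dvd
  set c := coeff 2 f.ser
  have hf : f.ser = X * (1 + C c * X + X ^ 2 * e) := by linear_combination he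
  obtain ⟨d, hd⟩ : (X : K⟦X⟧) ^ 2 ∣ q.subst f.ser - q := by
    have := X_pow_dvd_subst_sub_subst (a := 2) q constantCoeff_X f.X_sq_dvd
    rwa [X_subst] at this
  have hpow : ∀ n : ℕ, (X : K⟦X⟧) ^ 2 ∣
      (1 + C c * X + X ^ 2 * e) ^ n - (1 + C ((n : K) * c) * X) := by
    intro n
    induction n with
    | zero => simp
    | succ n ih =>
      obtain ⟨r, hr⟩ := ih
      refine ⟨r * (1 + C c * X + X ^ 2 * e) + C (n * c) * C c +
        (1 + C (n * c) * X) * e, ?_⟩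
      rw [pow_succ]
      have : C (((n + 1 : ℕ) : K) * c) = C (n * c) + C c := by
        rw [← map_add]; congr 1; push_cast; ring
      rw [this]
      linear_combination (1 + C c * X + X ^ 2 * e) * hr
  obtain ⟨r, hr⟩ := hpow s
  have hq : q.subst f.ser = q + X ^ 2 * d := by linear_combination hd
  have hp : (1 + C c * X + X ^ 2 * e) ^ s = 1 + C ((s : K) * c) * X + X ^ 2 * r := by
    linear_combination hr
  rw [hq, hf, mul_pow, hp]
  refine ⟨r * (q + X ^ 2 * d) + (1 + C ((s : K) * c) * X) * d, ?_⟩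
  rw [pow_add]
  ring

theorem X_pow_dvd_subst_sub_self {s : ℕ} (f : Nottingham K) {w : K⟦X⟧}
    (hw : (X : K⟦X⟧) ^ s ∣ w) : (X : K⟦X⟧) ^ (s + 1) ∣ w.subst f.ser - w := by
  have h := X_pow_dvd_of_le (by omega : s + 1 ≤ s + 2) (X_pow_dvd_subst_sub f hw)
  have h2 : (X : K⟦X⟧) ^ (s + 1) ∣ C ((s : K) * coeff 2 f.ser) * X * w := by
    rw [pow_succ', mul_assoc]
    exact (mul_dvd_mul_left X hw).mul_left _
  simpa using h.add h2

theorem X_pow_dvd_subst_sub_self_of_cast_eq_zero {s : ℕ} (hs : (s : K) = 0) (f : Nottingham K)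
    {w : K⟦X⟧} (hw : (X : K⟦X⟧) ^ s ∣ w) : (X : K⟦X⟧) ^ (s + 2) ∣ w.subst f.ser - w := by
  simpa [hs] using X_pow_dvd_subst_sub f hw

theorem Nottingham.X_sq_dvd_derivative (f : Nottingham K) :
    (X : K⟦X⟧) ^ 2 ∣ d⁄dX K f.ser - 1 - C (2 * coeff 2 f.ser) * X := by
  have h := X_pow_dvd_derivative f.X_cube_dvd
  have e : d⁄dX K (f.ser - X - C (coeff 2 f.ser) * X ^ 2) =
      d⁄dX K f.ser - 1 - C (2 * coeff 2 f.ser) * X := by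
    rw [map_sub, map_sub, Derivation.leibniz, Derivation.leibniz_pow]
    simp only [map_mul, map_ofNat, derivative_X, derivative_C, smul_eq_mul, nsmul_eq_mul]
    push_cast
    ring
  rwa [e] at h

/-- The leading term of the difference of the two composites of elements of `N(K)`. -/
theorem X_pow_dvd_comp_sub_comp {r : ℕ} (hr : 1 ≤ r) (f g : Nottingham K)
    (hg : (X : K⟦X⟧) ^ (r + 1) ∣ g.ser - X) :
    (X : K⟦X⟧) ^ (r + 3) ∣ (f * g).ser - (g * f).ser -
      C ((1 - (r : K)) * coeff 2 f.ser) * X * (g.ser - X) := by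
  have h1 := X_pow_dvd_of_le (by omega : r + 3 ≤ 2 * (r + 1))
    (taylor_subst (by omega) f.ser constantCoeff_X hg)
  rw [X_subst, X_subst, add_sub_cancel] at h1
  have h2 := X_pow_dvd_subst_sub f hg
  have h3 : (X : K⟦X⟧) ^ (r + 3) ∣ (d⁄dX K f.ser - 1 - C (2 * coeff 2 f.ser) * X) *
      (g.ser - X) := by
    rw [show r + 3 = 2 + (r + 1) by ring, pow_add]
    exact mul_dvd_mul f.X_sq_dvd_derivative hg
  rw [subst_sub f.hasSubst, subst_X f.hasSubst] at h2
  have h := dvd_sub (h1.add h3) h2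
  rw [Nottingham.ser_mul, Nottingham.ser_mul]
  convert h using 1
  have : C ((1 - (r : K)) * coeff 2 f.ser) =
      C (2 * coeff 2 f.ser) - C (((r + 1 : ℕ) : K) * coeff 2 f.ser) := by
    rw [← map_sub]; congr 1; push_cast; ring
  rw [this]
  ring

end Series

end RiordanGroup

namespace RiordanGroup

/-! ### Subgroups of N(K) defined by congruences, and leading coefficients. -/

section Subgroups

variable {K : Type u} [CommRing K]

theorem Nottingham.subst_inv_subst (u : K⟦X⟧) (k : Nottingham K) :
    PowerSeries.subst (k⁻¹).ser (u.subst k.ser) = u := by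
  have h := subst_comp_subst_apply k.hasSubst (k⁻¹).hasSubst u
  rw [h, ← Nottingham.ser_mul, mul_inv_cancel, Nottingham.ser_one, X_subst]

theorem Nottingham.X_pow_dvd_subst_iff {n : ℕ} {u : K⟦X⟧} (k : Nottingham K) :
    (X : K⟦X⟧) ^ n ∣ u.subst k.ser ↔ (X : K⟦X⟧) ^ n ∣ u := by
  refine ⟨fun h => ?_, X_pow_dvd_subst k.constCoeff_ser⟩
  simpa [k.subst_inv_subst] using X_pow_dvd_subst k⁻¹.constCoeff_ser h

theorem Nottingham.constantCoeff_derivative (k : Nottingham K) :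
    constantCoeff (d⁄dX K k.ser) = 1 := by
  rw [← coeff_zero_eq_constantCoeff_apply, coeff_derivative]
  simp [k.coeff_one_ser]

theorem Nottingham.isUnit_derivative (k : Nottingham K) : IsUnit (d⁄dX K k.ser) := by
  rw [PowerSeries.isUnit_iff_constantCoeff, k.constantCoeff_derivative]
  exact isUnit_one

/-- By the chain rule the derivative is u'(k) times the unit k', and substituting k preserves
orders. This makes the condition on g' in `Nottingham.shape` stable under composition. -/
theorem Nottingham.X_pow_dvd_derivative_subst_iff {n : ℕ} {u : K⟦X⟧} (k : Nottingham K) :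
    (X : K⟦X⟧) ^ n ∣ d⁄dX K (u.subst k.ser) ↔ (X : K⟦X⟧) ^ n ∣ d⁄dX K u := by
  rw [derivative_subst k.hasSubst, k.isUnit_derivative.dvd_mul_right, k.X_pow_dvd_subst_iff]

theorem Nottingham.ser_mul_sub_X (g k : Nottingham K) :
    (g * k).ser - X = (g.ser - X).subst k.ser + (k.ser - X) := by
  rw [Nottingham.ser_mul, subst_sub k.hasSubst, subst_X k.hasSubst]; ring

variable (K) in
/-- The subgroup of the `g ∈ N(K)` with `g ≡ x mod x^a` and `g' ≡ 1 mod x^c`. -/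
def Nottingham.shape (a c : ℕ) : Subgroup (Nottingham K) where
  carrier := {g | (X : K⟦X⟧) ^ a ∣ g.ser - X ∧ (X : K⟦X⟧) ^ c ∣ d⁄dX K (g.ser - X)}
  mul_mem' := fun {g k} hg hk => by
    refine ⟨?_, ?_⟩
    · rw [Nottingham.ser_mul_sub_X]
      exact (k.X_pow_dvd_subst_iff.mpr hg.1).add hk.1
    · rw [Nottingham.ser_mul_sub_X, map_add]
      exact (k.X_pow_dvd_derivative_subst_iff.mpr hg.2).add hk.2
  one_mem' := by simp [Nottingham.ser_one]
  inv_mem' := fun {g} hg => by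
    have h : (g⁻¹).ser - X = - (g.ser - X).subst (g⁻¹).ser := by
      rw [subst_sub g⁻¹.hasSubst, subst_X g⁻¹.hasSubst, ← Nottingham.ser_mul, mul_inv_cancel,
        Nottingham.ser_one]
      ring
    refine ⟨?_, ?_⟩
    · rw [h, dvd_neg]; exact g⁻¹.X_pow_dvd_subst_iff.mpr hg.1
    · rw [h, map_neg, dvd_neg]; exact g⁻¹.X_pow_dvd_derivative_subst_iff.mpr hg.2

theorem Nottingham.mem_shape {a c : ℕ} {g : Nottingham K} : g ∈ Nottingham.shape K a c ↔
    (X : K⟦X⟧) ^ a ∣ g.ser - X ∧ (X : K⟦X⟧) ^ c ∣ d⁄dX K (g.ser - X) := Iff.rfl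

theorem Nottingham.mul_inv_ser_sub_X (u w : Nottingham K) :
    (u * w⁻¹).ser - X = (u.ser - w.ser).subst (w⁻¹).ser := by
  rw [subst_sub w⁻¹.hasSubst, ← Nottingham.ser_mul, ← Nottingham.ser_mul, mul_inv_cancel,
    Nottingham.ser_one]

theorem Nottingham.mul_inv_mem_shape {a c : ℕ} {u w : Nottingham K} :
    u * w⁻¹ ∈ Nottingham.shape K a c ↔
      (X : K⟦X⟧) ^ a ∣ u.ser - w.ser ∧ (X : K⟦X⟧) ^ c ∣ d⁄dX K (u.ser - w.ser) := by
  rw [Nottingham.mem_shape, Nottingham.mul_inv_ser_sub_X, w⁻¹.X_pow_dvd_subst_iff,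
    w⁻¹.X_pow_dvd_derivative_subst_iff]

theorem commutatorElement_eq_mul_inv {G : Type*} [Group G] (f g : G) :
    ⁅f, g⁆ = (f * g) * (g * f)⁻¹ := by
  rw [commutatorElement_def]; group

/-- Since ⁅f, g⁆ = (fg)(gf)⁻¹, composing on the right with gf turns ⁅f, g⁆ - x into fg - gf without
changing orders. Commutators can thus be studied through a difference of two power series. -/
theorem Nottingham.commutator_mem_shape {a c : ℕ} {f g : Nottingham K} :
    ⁅f, g⁆ ∈ Nottingham.shape K a c ↔
      (X : K⟦X⟧) ^ a ∣ (f * g).ser - (g * f).ser ∧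
        (X : K⟦X⟧) ^ c ∣ d⁄dX K ((f * g).ser - (g * f).ser) := by
  rw [commutatorElement_eq_mul_inv, Nottingham.mul_inv_mem_shape]

variable (K) in
/-- The subgroup of the `g ∈ N(K)` with `g ≡ x mod x^(r+1)`. -/
def Nottingham.depth (r : ℕ) : Subgroup (Nottingham K) := Nottingham.shape K (r + 1) 0

theorem Nottingham.mem_depth {r : ℕ} {g : Nottingham K} : g ∈ Nottingham.depth K r ↔
    (X : K⟦X⟧) ^ (r + 1) ∣ g.ser - X := by
  simp [Nottingham.depth, Nottingham.mem_shape]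

theorem Nottingham.mul_inv_mem_depth {r : ℕ} {u w : Nottingham K} :
    u * w⁻¹ ∈ Nottingham.depth K r ↔ (X : K⟦X⟧) ^ (r + 1) ∣ u.ser - w.ser := by
  simp [Nottingham.depth, Nottingham.mul_inv_mem_shape]

theorem Nottingham.commutator_mem_depth {r : ℕ} {f g : Nottingham K} :
    ⁅f, g⁆ ∈ Nottingham.depth K r ↔ (X : K⟦X⟧) ^ (r + 1) ∣ (f * g).ser - (g * f).ser := by
  simp [Nottingham.depth, Nottingham.commutator_mem_shape]

theorem Nottingham.depth_antitone : Antitone (Nottingham.depth K) := fun m n h g hg => by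
  rw [Nottingham.mem_depth] at hg ⊢
  exact X_pow_dvd_of_le (by omega) hg

theorem Nottingham.depth_zero : Nottingham.depth K 0 = ⊤ := by
  rw [eq_top_iff]
  intro g _
  rw [Nottingham.mem_depth]
  exact X_pow_dvd_of_le (by omega) g.X_sq_dvd

theorem Nottingham.depth_one : Nottingham.depth K 1 = ⊤ := by
  rw [eq_top_iff]
  intro g _
  rw [Nottingham.mem_depth]
  exact X_pow_dvd_of_le (by omega) g.X_sq_dvd

theorem Nottingham.commutator_mem_depth_succ {r : ℕ} (f : Nottingham K) {g : Nottingham K}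
    (hg : g ∈ Nottingham.depth K r) : ⁅f, g⁆ ∈ Nottingham.depth K (r + 1) := by
  -- Depths 0 and 1 are both the whole group, and the leading-term formula starts at r = 1.
  rcases Nat.eq_zero_or_pos r with rfl | hr
  · rw [Nottingham.depth_one]; trivial
  rw [Nottingham.mem_depth] at hg
  rw [Nottingham.commutator_mem_depth]
  have h1 := X_pow_dvd_of_le (by omega : r + 1 + 1 ≤ r + 3) (X_pow_dvd_comp_sub_comp hr f g hg)
  have h2 : (X : K⟦X⟧) ^ (r + 1 + 1) ∣ C ((1 - (r : K)) * coeff 2 f.ser) * X * (g.ser - X) := by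
    rw [mul_assoc, pow_succ']
    exact (mul_dvd_mul_left X hg).mul_left _
  simpa using h1.add h2

/-- The leading coefficient of fg - gf has the factor 1 - r, which vanishes here, so one more step
is gained. -/
theorem Nottingham.commutator_mem_depth_add_two {r : ℕ} (hr : (r : K) = 1) (hr0 : 1 ≤ r)
    (f : Nottingham K) {g : Nottingham K}
    (hg : g ∈ Nottingham.depth K r) : ⁅f, g⁆ ∈ Nottingham.depth K (r + 2) := by
  rw [Nottingham.mem_depth] at hg
  rw [Nottingham.commutator_mem_depth]
  simpa [hr] using X_pow_dvd_comp_sub_comp hr0 f g hg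

instance Nottingham.depth_normal (r : ℕ) : (Nottingham.depth K r).Normal where
  conj_mem g hg f := by
    have h := mul_mem (Nottingham.depth_antitone (Nat.le_succ r)
      (Nottingham.commutator_mem_depth_succ f hg)) hg
    rwa [commutatorElement_def, inv_mul_cancel_right] at h

/-- The leading term of a commutator in `N(K)`. -/
theorem Nottingham.commutator_ser_sub {m : ℕ} {f g : Nottingham K}
    (h : (X : K⟦X⟧) ^ (m + 1) ∣ (f * g).ser - (g * f).ser) :
    (X : K⟦X⟧) ^ (m + 2) ∣ (⁅f, g⁆.ser - X) - ((f * g).ser - (g * f).ser) := by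
  have e : (⁅f, g⁆.ser - X).subst (g * f).ser = (f * g).ser - (g * f).ser := by
    rw [subst_sub (g * f).hasSubst, subst_X (g * f).hasSubst, ← Nottingham.ser_mul,
      commutatorElement_eq_mul_inv, inv_mul_cancel_right]
  have h1 := X_pow_dvd_subst_sub_self (g * f) (Nottingham.mem_depth.mp
    (Nottingham.commutator_mem_depth.mpr h))
  rw [e] at h1
  rw [← dvd_neg, neg_sub]
  exact h1

/-- The elements of `N(K)` of the form `x + τ x^(m+1) + ⋯`. -/
def Nottingham.HasLead (m : ℕ) (τ : K) (g : Nottingham K) : Prop :=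
  (X : K⟦X⟧) ^ (m + 2) ∣ g.ser - X - C τ * X ^ (m + 1)

theorem Nottingham.HasLead.mem_depth {m : ℕ} {τ : K} {g : Nottingham K} (h : g.HasLead m τ) :
    g ∈ Nottingham.depth K m := by
  rw [Nottingham.mem_depth]
  simpa using (X_pow_dvd_of_le (by omega : m + 1 ≤ m + 2) h).add (Dvd.intro_left (C τ) rfl)

theorem Nottingham.exists_hasLead {m : ℕ} {g : Nottingham K}
    (h : g ∈ Nottingham.depth K m) : g.HasLead m (coeff (m + 1) (g.ser - X)) := by
  rw [Nottingham.mem_depth, X_pow_dvd_iff] at h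
  rw [Nottingham.HasLead, X_pow_dvd_iff]
  intro n hn
  rcases Nat.lt_succ_iff_lt_or_eq.mp hn with h1 | rfl
  · rw [map_sub, h n h1, coeff_C_mul, coeff_X_pow, if_neg (by omega)]; simp
  · rw [map_sub, coeff_C_mul_X_pow, if_pos rfl, sub_self]

theorem Nottingham.HasLead.commutator {m : ℕ} {τ : K} {f g : Nottingham K}
    (h : (X : K⟦X⟧) ^ (m + 2) ∣ (f * g).ser - (g * f).ser - C τ * X ^ (m + 1)) :
    ⁅f, g⁆.HasLead m τ := by
  have h1 : (X : K⟦X⟧) ^ (m + 1) ∣ (f * g).ser - (g * f).ser := by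
    simpa using (X_pow_dvd_of_le (by omega : m + 1 ≤ m + 2) h).add
      (Dvd.intro_left (C τ) rfl)
  rw [Nottingham.HasLead]
  convert (Nottingham.commutator_ser_sub h1).add h using 1
  ring

theorem Nottingham.HasLead.mul {m : ℕ} {τ σ : K} {f g : Nottingham K}
    (hf : f.HasLead m τ) (hg : g.HasLead m σ) : (f * g).HasLead m (τ + σ) := by
  have h1 := X_pow_dvd_subst_sub_self g (Nottingham.mem_depth.mp hf.mem_depth)
  rw [Nottingham.HasLead] at *
  rw [Nottingham.ser_mul_sub_X, map_add]
  convert (h1.add hf).add hg using 1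
  ring

theorem Nottingham.HasLead.inv {m : ℕ} {τ : K} {f : Nottingham K}
    (hf : f.HasLead m τ) : f⁻¹.HasLead m (-τ) := by
  have h1 := X_pow_dvd_subst_sub_self f⁻¹ (Nottingham.mem_depth.mp hf.mem_depth)
  have h : (f⁻¹).ser - X = - (f.ser - X).subst (f⁻¹).ser := by
    rw [subst_sub f⁻¹.hasSubst, subst_X f⁻¹.hasSubst, ← Nottingham.ser_mul, mul_inv_cancel,
      Nottingham.ser_one]
    ring
  rw [Nottingham.HasLead] at *
  rw [h, map_neg]
  rw [← dvd_neg]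
  convert h1.add hf using 1
  ring

theorem Nottingham.HasLead.one (m : ℕ) : (1 : Nottingham K).HasLead m 0 := by
  simp [Nottingham.HasLead, Nottingham.ser_one]

theorem Nottingham.HasLead.mem_depth_succ {m : ℕ} {f : Nottingham K} (hf : f.HasLead m 0) :
    f ∈ Nottingham.depth K (m + 1) := by
  rw [Nottingham.mem_depth]
  simpa [Nottingham.HasLead] using hf

theorem Nottingham.HasLead.mul_inv_mem {m : ℕ} {τ : K} {f g : Nottingham K}
    (hf : f.HasLead m τ) (hg : g.HasLead m τ) : f * g⁻¹ ∈ Nottingham.depth K (m + 1) := by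
  rw [Nottingham.mul_inv_mem_depth]
  rw [Nottingham.HasLead] at *
  convert hf.sub hg using 1
  ring

/-! ### The filtration of `H(K)` -/

theorem HSeries.ser_inv_mul (h : HSeries K) : (h⁻¹).ser * h.ser = 1 := by
  rw [← HSeries.ser_mul, inv_mul_cancel, HSeries.ser_one]

theorem HSeries.isUnit_ser (h : HSeries K) : IsUnit h.ser :=
  IsUnit.of_mul_eq_one_right _ h.ser_inv_mul

variable (K) in
/-- The subgroup of the `h ∈ H(K)` with `h ≡ 1 mod x^s`. -/
def HSeries.level (s : ℕ) : Subgroup (HSeries K) where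
  carrier := {h | (X : K⟦X⟧) ^ s ∣ h.ser - 1}
  mul_mem' := fun {g k} hg hk => by
    have : (g * k).ser - 1 = (g.ser - 1) * k.ser + (k.ser - 1) := by
      rw [HSeries.ser_mul]; ring
    rw [Set.mem_ofPred_eq, this]
    exact (hg.mul_right _).add hk
  one_mem' := by simp [HSeries.ser_one]
  inv_mem' := fun {g} hg => by
    have : (g⁻¹).ser - 1 = - (g⁻¹).ser * (g.ser - 1) := by
      linear_combination g.ser_inv_mul
    rw [Set.mem_ofPred_eq, this]
    exact Dvd.dvd.mul_left hg _

theorem HSeries.mem_level {s : ℕ} {h : HSeries K} :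
    h ∈ HSeries.level K s ↔ (X : K⟦X⟧) ^ s ∣ h.ser - 1 := Iff.rfl

theorem HSeries.div_mem_level {s : ℕ} {h k : HSeries K} :
    h / k ∈ HSeries.level K s ↔ (X : K⟦X⟧) ^ s ∣ h.ser - k.ser := by
  have : h.ser - k.ser = k.ser * ((h / k).ser - 1) := by
    rw [div_eq_mul_inv, HSeries.ser_mul]
    linear_combination (-h.ser) * k.ser_inv_mul
  rw [this, k.isUnit_ser.dvd_mul_left, HSeries.mem_level]

theorem HSeries.level_antitone : Antitone (HSeries.level K) := fun m n h g hg => by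
  rw [HSeries.mem_level] at hg ⊢
  exact X_pow_dvd_of_le h hg

theorem HSeries.level_zero : HSeries.level K 0 = ⊤ := by
  rw [eq_top_iff]
  intro g _
  simp [HSeries.mem_level]

theorem HSeries.level_one : HSeries.level K 1 = ⊤ := by
  rw [eq_top_iff]
  intro g _
  rw [HSeries.mem_level, pow_one, X_dvd_iff]
  simp [g.constCoeff_ser]

theorem HSeries.comp_sub_one (h : HSeries K) (g : Nottingham K) :
    (h.comp g).ser - 1 = (h.ser - 1).subst g.ser := by
  have h1 : (1 : K⟦X⟧).subst g.ser = 1 := by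
    rw [← coe_substAlgHom g.hasSubst, map_one]
  rw [subst_sub g.hasSubst, h1]
  rfl

theorem HSeries.comp_mem_level {s : ℕ} {h : HSeries K} (hh : h ∈ HSeries.level K s)
    (g : Nottingham K) : h.comp g ∈ HSeries.level K s := by
  rw [HSeries.mem_level] at hh ⊢
  rw [HSeries.comp_sub_one]
  exact X_pow_dvd_subst g.constCoeff_ser hh

theorem HSeries.comp_sub (h : HSeries K) (g : Nottingham K) :
    (h.comp g).ser - h.ser = (h.ser - 1).subst g.ser - (h.ser - 1) := by
  rw [← HSeries.comp_sub_one]; ring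

theorem HSeries.comp_div_mem_level_succ {s : ℕ} {h : HSeries K} (hh : h ∈ HSeries.level K s)
    (g : Nottingham K) : h.comp g / h ∈ HSeries.level K (s + 1) := by
  rw [HSeries.div_mem_level, HSeries.comp_sub]
  exact X_pow_dvd_subst_sub_self g hh

theorem HSeries.comp_div_mem_level_add_two {s : ℕ} (hs : (s : K) = 0) {h : HSeries K}
    (hh : h ∈ HSeries.level K s) (g : Nottingham K) : h.comp g / h ∈ HSeries.level K (s + 2) := by
  rw [HSeries.div_mem_level, HSeries.comp_sub]
  exact X_pow_dvd_subst_sub_self_of_cast_eq_zero hs g hh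

theorem HSeries.comp_div_mem_level_of_dvd {r : ℕ} (h : HSeries K) {g : Nottingham K}
    (hg : (X : K⟦X⟧) ^ r ∣ g.ser - X) : h.comp g / h ∈ HSeries.level K r := by
  rw [HSeries.div_mem_level]
  have := X_pow_dvd_subst_sub_subst h.ser constantCoeff_X hg
  rwa [X_subst] at this

end Subgroups

end RiordanGroup

namespace RiordanGroup

/-! ### Topological groups that are complete for a descending chain of normal subgroups. -/

section Filtration

/-- The topology of `G` is that of the inverse limit of the discrete groups `G / U n`, and `G` is
equal to this limit. -/
structure IsFiltration {G : Type u} [Group G] [TopologicalSpace G] (U : ℕ → Subgroup G) :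
    Prop where
  normal : ∀ n, (U n).Normal
  antitone : Antitone U
  isOpen_coset : ∀ n g, IsOpen {x | x * g⁻¹ ∈ U n}
  basis : ∀ V : Set G, IsOpen V → ∀ g ∈ V, ∃ n, ∀ x, x * g⁻¹ ∈ U n → x ∈ V
  separated : ∀ x, (∀ n, x ∈ U n) → x = 1
  complete : ∀ a : ℕ → G, (∀ n, a (n + 1) * (a n)⁻¹ ∈ U n) → ∃ x, ∀ n, x * (a n)⁻¹ ∈ U n

theorem quotient_mk_eq_iff {G : Type u} [Group G] {N : Subgroup G} (hN : N.Normal) {a b : G} :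
    (a : G ⧸ N) = b ↔ a * b⁻¹ ∈ N := by
  rw [eq_comm, QuotientGroup.eq, hN.mem_comm_iff]

variable {G : Type u} [Group G] [TopologicalSpace G] {U : ℕ → Subgroup G}

/-- The inverse system of the quotients by a descending sequence of normal subgroups. -/
def quotientSystem {G : Type u} [Group G] (U : ℕ → Subgroup G) (hn : ∀ n, (U n).Normal)
    (ha : Antitone U) : InvSystem.{u, u} (ULift.{u} ℕ) where
  obj i := G ⧸ U i.down
  grp i := haveI := hn i.down; inferInstance
  map {i j} h :=
    haveI := hn i.down
    haveI := hn j.down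
    QuotientGroup.map _ _ (MonoidHom.id G) (ha h)
  map_self i x := by
    induction x using QuotientGroup.induction_on with
    | H z => rfl
  map_map {i j k} hij hjk x := by
    induction x using QuotientGroup.induction_on with
    | H z => rfl

theorem IsFiltration.dense_iff (hU : IsFiltration U) {S : Set G} :
    Dense S ↔ ∀ n g, ∃ s ∈ S, s * g⁻¹ ∈ U n := by
  constructor
  · intro h n g
    obtain ⟨s, hs, hsS⟩ := h.inter_open_nonempty _ (hU.isOpen_coset n g)
      ⟨g, by simp [one_mem]⟩
    exact ⟨s, hsS, hs⟩
  · intro h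
    rw [dense_iff_inter_open]
    rintro V hV ⟨g, hg⟩
    obtain ⟨n, hn⟩ := hU.basis V hV g hg
    obtain ⟨s, hs, hsn⟩ := h n g
    exact ⟨s, hn s hsn, hs⟩

theorem IsFiltration.continuous_mk (hU : IsFiltration U) (n : ℕ) :
    @Continuous G (G ⧸ U n) _ ⊥ (fun g => (g : G ⧸ U n)) := by
  let : TopologicalSpace (G ⧸ U n) := ⊥
  refine continuous_def.mpr fun V _ => ?_
  rw [isOpen_iff_forall_mem_open]
  intro g hg
  refine ⟨_, fun x hx => ?_, hU.isOpen_coset n g, by simp [one_mem]⟩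
  have : (x : G ⧸ U n) = g := (quotient_mk_eq_iff (hU.normal n)).mpr hx
  rw [Set.mem_preimage, this]
  exact hg

/-- The map to the compatible families of cosets is injective by separatedness and surjective by
completeness; it is continuous because cosets are open, and open because they form a basis. -/
theorem IsFiltration.nonempty_continuousMulEquiv (hU : IsFiltration U) :
    Nonempty (G ≃ₜ* (quotientSystem U hU.normal hU.antitone).limit) := by
  set D := quotientSystem U hU.normal hU.antitone with hD
  let φ : G → D.limit := fun g => ⟨fun i => (g : G ⧸ U i.down), fun i j hij => rfl⟩
  have hφ : ∀ x y, φ (x * y) = φ x * φ y := fun x y => rfl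
  have hinj : Function.Injective φ := by
    intro x y hxy
    have h : ∀ n, x * y⁻¹ ∈ U n := fun n => by
      rw [← quotient_mk_eq_iff (hU.normal n)]
      exact congrFun (congrArg Subtype.val hxy) ⟨n⟩
    exact mul_inv_eq_one.mp (hU.separated _ h)
  have hsurj : Function.Surjective φ := by
    rintro ⟨x, hx⟩
    have hq : ∀ n : ℕ, ∃ a : G, (a : G ⧸ U n) = x ⟨n⟩ := fun n => QuotientGroup.mk_surjective _
    choose a ha using hq
    obtain ⟨g, hg⟩ := hU.complete a (fun n => by
      rw [← quotient_mk_eq_iff (hU.normal n), ha n]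
      have := hx ⟨n⟩ ⟨n + 1⟩ (Nat.le_succ n)
      rw [← this, ← ha (n + 1)]
      rfl)
    refine ⟨g, Subtype.ext (funext fun i => ?_)⟩
    have := (quotient_mk_eq_iff (hU.normal i.down)).mpr (hg i.down)
    exact this.trans (ha i.down)
  have hcont : Continuous φ := by
    refine continuous_induced_rng.mpr ?_
    exact @continuous_pi _ _ _ _ (fun _ => ⊥) _ fun i => hU.continuous_mk i.down
  have hopen : IsOpenMap φ := by
    intro V hV
    rw [isOpen_iff_forall_mem_open]
    rintro _ ⟨g, hg, rfl⟩
    obtain ⟨n, hn⟩ := hU.basis V hV g hg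
    let : ∀ i, TopologicalSpace (D.obj i) := fun _ => ⊥
    have : ∀ i, DiscreteTopology (D.obj i) := fun _ => ⟨rfl⟩
    have hc : Continuous fun y : D.limit => (y : ∀ i, D.obj i) ⟨n⟩ :=
      (continuous_apply _).comp continuous_induced_dom
    refine ⟨(fun y : D.limit => (y : ∀ i, D.obj i) ⟨n⟩) ⁻¹' {(g : G ⧸ U n)}, ?_,
      (isOpen_discrete _).preimage hc, rfl⟩
    intro y hy
    obtain ⟨x, rfl⟩ := hsurj y
    exact ⟨x, hn x ((quotient_mk_eq_iff (hU.normal n)).mp hy), rfl⟩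
  let e := Equiv.ofBijective φ ⟨hinj, hsurj⟩
  exact ⟨⟨MulEquiv.mk e hφ, hcont, (e.toHomeomorphOfContinuousOpen hcont hopen).continuous_symm⟩⟩

theorem IsFiltration.isPro (hU : IsFiltration U) (𝒞 : ∀ (H : Type u) [Group H], Prop)
    (h : ∀ n, haveI := hU.normal n; 𝒞 (G ⧸ U n)) : IsPro 𝒞 G :=
  ⟨ULift.{u} ℕ, inferInstance, inferInstance, inferInstance,
    quotientSystem U hU.normal hU.antitone, fun i => h i.down, hU.nonempty_continuousMulEquiv⟩

theorem InvSystem.compactSpace_limit {I : Type u} [PartialOrder I] (D : InvSystem.{u, v} I)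
    (hD : ∀ i, Finite (D.obj i)) : CompactSpace D.limit := by
  let : ∀ i, TopologicalSpace (D.obj i) := fun _ => ⊥
  have : ∀ i, DiscreteTopology (D.obj i) := fun _ => ⟨rfl⟩
  have hc : IsClosed (D.limit : Set (∀ i, D.obj i)) := by
    have : (D.limit : Set (∀ i, D.obj i)) =
        ⋂ i, ⋂ j, ⋂ hij : i ≤ j, {x | D.map hij (x j) = x i} := by
      ext x
      simp only [Set.mem_iInter]
      rfl
    rw [this]
    exact isClosed_iInter fun i => isClosed_iInter fun j => isClosed_iInter fun hij =>
      isClosed_eq (continuous_of_discreteTopology.comp (continuous_apply j)) (continuous_apply i)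
  exact isCompact_iff_compactSpace.mp hc.isCompact

theorem IsFiltration.compactSpace (hU : IsFiltration U) (h : ∀ n, Finite (G ⧸ U n)) :
    CompactSpace G := by
  obtain ⟨e⟩ := hU.nonempty_continuousMulEquiv
  have := InvSystem.compactSpace_limit (quotientSystem U hU.normal hU.antitone)
    fun i => h i.down
  exact e.toHomeomorph.symm.compactSpace

theorem IsFiltration.isTopologicalGroup (hU : IsFiltration U) : IsTopologicalGroup G := by
  have key : ∀ {Y : Type u} [TopologicalSpace Y] (F : Y → G),
      (∀ n y, ∃ W, IsOpen W ∧ y ∈ W ∧ ∀ z ∈ W, F z * (F y)⁻¹ ∈ U n) → Continuous F := by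
    intro Y _ F hF
    refine continuous_def.mpr fun V hV => ?_
    rw [isOpen_iff_forall_mem_open]
    intro y hy
    obtain ⟨n, hn⟩ := hU.basis V hV _ hy
    obtain ⟨W, hW, hyW, hWF⟩ := hF n y
    exact ⟨W, fun z hz => hn _ (hWF z hz), hW, hyW⟩
  have hself : ∀ n g, g * g⁻¹ ∈ U n := fun n g => by simp [one_mem]
  refine { continuous_mul := key _ ?_, continuous_inv := key _ ?_ }
  · rintro n ⟨a, b⟩
    refine ⟨{x | x * a⁻¹ ∈ U n} ×ˢ {x | x * b⁻¹ ∈ U n},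
      (hU.isOpen_coset n a).prod (hU.isOpen_coset n b), ⟨hself n a, hself n b⟩, ?_⟩
    rintro ⟨x, y⟩ ⟨hx, hy⟩
    have hy' := (hU.normal n).conj_mem _ hy a
    have := mul_mem (show x * a⁻¹ ∈ U n from hx) hy'
    convert this using 1
    group
  · intro n a
    refine ⟨{x | x * a⁻¹ ∈ U n}, hU.isOpen_coset n a, hself n a, fun x hx => ?_⟩
    have := (hU.normal n).conj_mem _ (inv_mem hx) x⁻¹
    convert this using 1
    group

theorem IsFiltration.isClosed_coset (hU : IsFiltration U) (n : ℕ) (g : G) :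
    IsClosed {x | x * g⁻¹ ∈ U n} := by
  rw [← isOpen_compl_iff, isOpen_iff_forall_mem_open]
  intro y hy
  refine ⟨_, fun x hx hx' => hy ?_, hU.isOpen_coset n y, by simp [one_mem]⟩
  have := mul_mem (inv_mem (show x * y⁻¹ ∈ U n from hx)) (show x * g⁻¹ ∈ U n from hx')
  simpa [mul_assoc] using this

/-- A subgroup containing some U n is a union of its cosets, and so is its complement. -/
theorem IsFiltration.isClosed_subgroup (hU : IsFiltration U) {B : Subgroup G} {n : ℕ}
    (h : U n ≤ B) : IsClosed (B : Set G) := by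
  rw [← isOpen_compl_iff, isOpen_iff_forall_mem_open]
  intro y hy
  refine ⟨_, fun x hx hx' => hy ?_, hU.isOpen_coset n y, by simp [one_mem]⟩
  have := mul_mem (inv_mem (h (show x * y⁻¹ ∈ U n from hx))) (show x ∈ B from hx')
  simpa [mul_assoc] using this

/-- In a compact group, an equation that can be solved to any order of approximation by
successively improving the solution has an exact solution. -/
theorem IsFiltration.exists_eq (hU : IsFiltration U) {E : Type*} [TopologicalSpace E]
    [CompactSpace E] {B : Set E} (hB : IsClosed B) {Φ : E → G} (hΦ : Continuous Φ) (z : G)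
    {e₀ : E} (he₀ : e₀ ∈ B) (h₀ : Φ e₀ * z⁻¹ ∈ U 0)
    (h : ∀ n, ∀ e ∈ B, Φ e * z⁻¹ ∈ U n → ∃ e' ∈ B, Φ e' * z⁻¹ ∈ U (n + 1)) :
    ∃ e ∈ B, Φ e = z := by
  let A : ℕ → Set E := fun n => B ∩ Φ ⁻¹' {x | x * z⁻¹ ∈ U n}
  have hne : ∀ n, (A n).Nonempty := by
    intro n
    induction n with
    | zero => exact ⟨e₀, he₀, h₀⟩
    | succ n ih =>
      obtain ⟨e, he, hen⟩ := ih
      obtain ⟨e', he', hen'⟩ := h n e he hen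
      exact ⟨e', he', hen'⟩
  have hcl : ∀ n, IsClosed (A n) := fun n =>
    hB.inter ((hU.isClosed_coset n z).preimage hΦ)
  obtain ⟨e, he⟩ := IsCompact.nonempty_iInter_of_sequence_nonempty_isCompact_isClosed A
    (fun n e he => ⟨he.1, hU.antitone (Nat.le_succ n) he.2⟩) hne (hcl 0).isCompact hcl
  rw [Set.mem_iInter] at he
  exact ⟨e, (he 0).1, mul_inv_eq_one.mp (hU.separated _ fun n => (he n).2)⟩

end Filtration

end RiordanGroup

namespace RiordanGroup

/-! ### Coefficientwise convergence and the filtrations of H(K) and N(K). -/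

section Topology

variable {K : Type u} [CommRing K]

theorem isOpen_coeffTopology_congr (n : ℕ) (c : K⟦X⟧) :
    @IsOpen _ (coeffTopology K) {f : K⟦X⟧ | (X : K⟦X⟧) ^ n ∣ f - c} := by
  let : TopologicalSpace K := ⊥
  have : DiscreteTopology K := ⟨rfl⟩
  refine isOpen_induced_iff.mpr ⟨Set.pi (Finset.range n) fun i => {coeff i c},
    isOpen_set_pi (Finset.finite_toSet _) fun _ _ => isOpen_discrete _, ?_⟩
  ext f
  simp [X_pow_dvd_iff, sub_eq_zero]

theorem exists_congr_of_isOpen_coeffTopology {V : Set K⟦X⟧} (hV : @IsOpen _ (coeffTopology K) V)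
    {c : K⟦X⟧} (hc : c ∈ V) : ∃ n : ℕ, ∀ f, (X : K⟦X⟧) ^ n ∣ f - c → f ∈ V := by
  let : TopologicalSpace K := ⊥
  have : DiscreteTopology K := ⟨rfl⟩
  obtain ⟨W, hW, rfl⟩ := isOpen_induced_iff.mp hV
  obtain ⟨I, u, hu, hIu⟩ := isOpen_pi_iff.mp hW _ hc
  refine ⟨I.sup id + 1, fun f hf => hIu fun i hi => ?_⟩
  have hi' : i < I.sup id + 1 := Nat.lt_succ_of_le (Finset.le_sup (f := id) hi)
  have := X_pow_dvd_iff.mp hf i hi'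
  rw [map_sub, sub_eq_zero] at this
  change coeff i f ∈ u i
  rw [this]
  exact (hu i hi).2

theorem exists_X_pow_dvd_sub (a : ℕ → K⟦X⟧) (h : ∀ n, (X : K⟦X⟧) ^ n ∣ a (n + 1) - a n) :
    ∃ f : K⟦X⟧, ∀ n, (X : K⟦X⟧) ^ n ∣ f - a n := by
  have hc : ∀ i k, coeff i (a (i + 1 + k)) = coeff i (a (i + 1)) := by
    intro i k
    induction k with
    | zero => rfl
    | succ k ih =>
      have := X_pow_dvd_iff.mp (h (i + 1 + k)) i (by omega)
      rw [map_sub, sub_eq_zero, ih] at this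
      exact this
  -- The coefficient of x^i is constant from stage i + 1 on.
  refine ⟨PowerSeries.mk fun i => coeff i (a (i + 1)), fun n => ?_⟩
  rw [X_pow_dvd_iff]
  intro i hi
  obtain ⟨k, rfl⟩ := Nat.exists_eq_add_of_le (Nat.succ_le_of_lt hi)
  rw [map_sub, coeff_mk, Nat.succ_eq_add_one, hc, sub_self]

theorem eq_zero_of_forall_X_pow_dvd {f : K⟦X⟧} (h : ∀ n, (X : K⟦X⟧) ^ n ∣ f) : f = 0 := by
  ext i
  rw [X_pow_dvd_iff.mp (h (i + 1)) i (Nat.lt_succ_self i), map_zero]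

variable (K) in
theorem HSeries.isFiltration : IsFiltration (HSeries.level K) where
  normal n := inferInstance
  antitone := HSeries.level_antitone
  isOpen_coset n g := by
    simp_rw [← div_eq_mul_inv, HSeries.div_mem_level]
    exact (@isOpen_induced_iff _ _ (coeffTopology K) _ _).mpr ⟨_, isOpen_coeffTopology_congr n g.ser, rfl⟩
  basis V hV g hg := by
    obtain ⟨W, hW, rfl⟩ := (@isOpen_induced_iff _ _ (coeffTopology K) _ _).mp hV
    obtain ⟨n, hn⟩ := exists_congr_of_isOpen_coeffTopology hW hg
    refine ⟨n, fun x hx => hn _ ?_⟩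
    rwa [← HSeries.div_mem_level, div_eq_mul_inv]
  separated x hx := HSeries.ext (sub_eq_zero.mp (eq_zero_of_forall_X_pow_dvd hx))
  complete a ha := by
    simp_rw [← div_eq_mul_inv, HSeries.div_mem_level] at ha ⊢
    obtain ⟨f, hf⟩ := exists_X_pow_dvd_sub (fun n => (a n).ser) ha
    refine ⟨⟨f, ?_⟩, hf⟩
    have := X_dvd_iff.mp (pow_one (X : K⟦X⟧) ▸ hf 1)
    rwa [map_sub, (a 1).constCoeff_ser, sub_eq_zero] at this

variable (K) in
theorem Nottingham.isFiltration : IsFiltration (Nottingham.depth K) where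
  normal n := inferInstance
  antitone := Nottingham.depth_antitone
  isOpen_coset n g := by
    simp_rw [Nottingham.mul_inv_mem_depth]
    exact (@isOpen_induced_iff _ _ (coeffTopology K) _ _).mpr ⟨_, isOpen_coeffTopology_congr (n + 1) g.ser, rfl⟩
  basis V hV g hg := by
    obtain ⟨W, hW, rfl⟩ := (@isOpen_induced_iff _ _ (coeffTopology K) _ _).mp hV
    obtain ⟨n, hn⟩ := exists_congr_of_isOpen_coeffTopology hW hg
    refine ⟨n, fun x hx => hn _ ?_⟩
    exact X_pow_dvd_of_le (by omega) (Nottingham.mul_inv_mem_depth.mp hx)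
  separated x hx := Nottingham.ext (sub_eq_zero.mp (eq_zero_of_forall_X_pow_dvd
    fun n => X_pow_dvd_of_le (by omega) (Nottingham.mem_depth.mp (hx n))))
  complete a ha := by
    simp_rw [Nottingham.mul_inv_mem_depth] at ha ⊢
    -- Depth n means congruence modulo x^(n+1), so the sequence is shifted by one; the repeated term
    -- created by 0 - 1 = 0 is harmless.
    obtain ⟨f, hf⟩ := exists_X_pow_dvd_sub (fun n => (a (n - 1)).ser) (fun n => by
      rcases n with _ | n
      · simp
      · exact ha n)
    have h2 := X_pow_dvd_iff.mp (hf 2)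
    refine ⟨⟨f, ?_, ?_⟩, fun n => hf (n + 1)⟩
    · have := h2 0 (by omega)
      rwa [coeff_zero_eq_constantCoeff, map_sub, Nottingham.constCoeff_ser, sub_zero] at this
    · have := h2 1 (by omega)
      rwa [map_sub, Nottingham.coeff_one_ser, sub_eq_zero] at this

end Topology

/-! ### Subgroups of R(K) and their commutators. -/

section SemidirectSubgroups

variable {K : Type u} [CommRing K]

/-- The subgroup of the `(h, g) ∈ R(K)` with `h ≡ 1 mod x^s` and `g ∈ B`. -/
def Riordan.sub (s : ℕ) (B : Subgroup (Nottingham K)) : Subgroup (Riordan K) where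
  carrier := {r | r.left ∈ HSeries.level K s ∧ r.right.unop ∈ B}
  mul_mem' := fun {a _} ha hb =>
    ⟨mul_mem ha.1 (HSeries.comp_mem_level hb.1 a.right.unop), mul_mem hb.2 ha.2⟩
  one_mem' := ⟨one_mem _, one_mem _⟩
  inv_mem' := fun {a} ha =>
    ⟨HSeries.comp_mem_level (inv_mem ha.1) (a.right.unop)⁻¹, inv_mem ha.2⟩

theorem Riordan.mem_sub {s : ℕ} {B : Subgroup (Nottingham K)} {r : Riordan K} :
    r ∈ Riordan.sub s B ↔ r.left ∈ HSeries.level K s ∧ r.right.unop ∈ B := Iff.rfl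

theorem Riordan.sub_mono {s s' : ℕ} (hs : s' ≤ s) {B B' : Subgroup (Nottingham K)} (hB : B ≤ B') :
    Riordan.sub s B ≤ Riordan.sub s' B' :=
  fun _ hr => ⟨HSeries.level_antitone hs hr.1, hB hr.2⟩

/-- The first component of x⁻¹y is the quotient of the first components followed by a substitution,
which preserves the levels of H(K). -/
theorem Riordan.inv_mul_mem_sub {s : ℕ} {B : Subgroup (Nottingham K)} {x y : Riordan K} :
    x⁻¹ * y ∈ Riordan.sub s B ↔
      y.left / x.left ∈ HSeries.level K s ∧ y.right.unop * x.right.unop⁻¹ ∈ B := by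
  have h : (x⁻¹ * y).left = (y.left / x.left).comp (x.right.unop)⁻¹ := by
    rw [div_eq_mul_inv, mul_comm, HSeries.mul_comp]
    rfl
  rw [Riordan.mem_sub, h]
  refine and_congr_left fun _ => ⟨fun h' => ?_, fun h' => HSeries.comp_mem_level h' _⟩
  have := HSeries.comp_mem_level h' x.right.unop
  rwa [HSeries.comp_comp, inv_mul_cancel, HSeries.comp_one] at this

/-- Up to substitution, the first component of (yx)⁻¹(xy) is the quotient of h_y(g_x)/h_y by
h_x(g_y)/h_x, and the second component is governed by a commutator in N(K). The three hypotheses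
control these three pieces. -/
theorem Riordan.commutator_sub_le {s s' : ℕ} {B B' : Subgroup (Nottingham K)}
    (h₁ : ∀ f : Nottingham K, ∀ g ∈ B, ⁅f, g⁆ ∈ B')
    (h₂ : ∀ h ∈ HSeries.level K s, ∀ f, h.comp f / h ∈ HSeries.level K s')
    (h₃ : ∀ h, ∀ g ∈ B, h.comp g / h ∈ HSeries.level K s') :
    ⁅Riordan.sub s B, (⊤ : Subgroup (Riordan K))⁆ ≤ Riordan.sub s' B' := by
  have key : ∀ x ∈ Riordan.sub s B, ∀ y : Riordan K, ⁅x⁻¹, y⁻¹⁆ ∈ Riordan.sub s' B' := by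
    intro x hx y
    have e : ⁅x⁻¹, y⁻¹⁆ = (y * x)⁻¹ * (x * y) := by rw [commutatorElement_def]; group
    rw [e, Riordan.inv_mul_mem_sub]
    constructor
    · change (x.left * y.left.comp x.right.unop) / (y.left * x.left.comp y.right.unop) ∈ _
      have := div_mem (h₃ y.left x.right.unop hx.2) (h₂ x.left hx.1 y.right.unop)
      convert this using 1
      rw [div_div_div_eq, mul_comm x.left]
    · change (y.right.unop * x.right.unop) * (x.right.unop * y.right.unop)⁻¹ ∈ B'
      rw [← commutatorElement_eq_mul_inv]
      exact h₁ _ _ hx.2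
  rw [Subgroup.commutator_le]
  intro x hx y _
  simpa using key x⁻¹ (inv_mem hx) y⁻¹

variable (K) in
/-- The embedding `g ↦ (1, g⁻¹)` of `N(K)` in `R(K)`. -/
noncomputable def Riordan.embN : Nottingham K →* Riordan K :=
  SemidirectProduct.inr.comp (MulEquiv.inv' (Nottingham K)).toMonoidHom

theorem Riordan.embN_apply (g : Nottingham K) : Riordan.embN K g = Riordan.mk 1 g⁻¹ := rfl

theorem Riordan.mk_mem_commutator {s : ℕ} {B : Subgroup (Nottingham K)} {z : Nottingham K}
    (hz : z ∈ ⁅B, (⊤ : Subgroup (Nottingham K))⁆) : Riordan.mk 1 z ∈ ⁅Riordan.sub s B, (⊤ : Subgroup (Riordan K))⁆ := by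
  have h1 : Riordan.embN K z⁻¹ ∈ (⁅B, (⊤ : Subgroup (Nottingham K))⁆).map (Riordan.embN K) :=
    Subgroup.mem_map_of_mem _ (inv_mem hz)
  rw [Subgroup.map_commutator, Riordan.embN_apply, inv_inv] at h1
  refine Subgroup.commutator_mono ?_ le_top h1
  rintro _ ⟨g, hg, rfl⟩
  exact ⟨one_mem _, inv_mem hg⟩

theorem HSeries.one_comp (g : Nottingham K) : (1 : HSeries K).comp g = 1 :=
  map_one (substAction K (MulOpposite.op g))

/-- This produces elements of H(K) in a commutator subgroup in two ways: from h in a small level and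
arbitrary g, or from arbitrary h and g close to x. -/
theorem Riordan.commutator_mk (h : HSeries K) (g : Nottingham K) :
    ⁅Riordan.mk 1 g, Riordan.mk h 1⁆ = Riordan.mk (h.comp g / h) 1 := by
  rw [commutatorElement_eq_mul_inv, mul_inv_eq_iff_eq_mul]
  simp only [Riordan.mk_mul_mk, HSeries.comp_one, one_mul, mul_one, div_mul_cancel]

theorem Riordan.mk_comp_div_mem_commutator {s : ℕ} {B : Subgroup (Nottingham K)} {h : HSeries K}
    (hh : h ∈ HSeries.level K s) (g : Nottingham K) :
    Riordan.mk (h.comp g / h) 1 ∈ ⁅Riordan.sub s B, (⊤ : Subgroup (Riordan K))⁆ := by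
  rw [← Riordan.commutator_mk, Subgroup.commutator_comm]
  exact Subgroup.commutator_mem_commutator trivial ⟨hh, one_mem _⟩

theorem Riordan.mk_comp_div_mem_commutator' {s : ℕ} {B : Subgroup (Nottingham K)} (h : HSeries K)
    {g : Nottingham K} (hg : g ∈ B) : Riordan.mk (h.comp g / h) 1 ∈ ⁅Riordan.sub s B, (⊤ : Subgroup (Riordan K))⁆ := by
  rw [← Riordan.commutator_mk]
  exact Subgroup.commutator_mem_commutator ⟨one_mem _, hg⟩ trivial

theorem Riordan.sub_le {s : ℕ} {B : Subgroup (Nottingham K)} {L : Subgroup (Riordan K)}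
    (h₁ : ∀ h ∈ HSeries.level K s, Riordan.mk h 1 ∈ L) (h₂ : ∀ g ∈ B, Riordan.mk 1 g ∈ L) :
    Riordan.sub s B ≤ L := by
  rintro ⟨h, g⟩ ⟨hh, hg⟩
  have := mul_mem (h₁ h hh) (h₂ g.unop hg)
  rw [Riordan.mk_mul_mk, HSeries.one_comp, mul_one, mul_one] at this
  exact this

variable (K) in
/-- The subgroup `R^n(K)` of the `(h, g)` with `h ≡ 1 mod x^n` and `g ≡ x mod x^(n+1)`. -/
def Riordan.level (n : ℕ) : Subgroup (Riordan K) := Riordan.sub n (Nottingham.depth K n)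

theorem Riordan.commutator_level_le (n : ℕ) :
    ⁅Riordan.level K n, (⊤ : Subgroup (Riordan K))⁆ ≤ Riordan.level K (n + 1) :=
  Riordan.commutator_sub_le (fun f _ hg => Nottingham.commutator_mem_depth_succ f hg)
    (fun _ hh f => HSeries.comp_div_mem_level_succ hh f)
    (fun h _ hg => HSeries.comp_div_mem_level_of_dvd h (Nottingham.mem_depth.mp hg))

theorem Riordan.level_antitone : Antitone (Riordan.level K) :=
  fun _ _ h => Riordan.sub_mono h (Nottingham.depth_antitone h)

instance Riordan.level_normal (n : ℕ) : (Riordan.level K n).Normal :=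
  Subgroup.commutator_top_right_le_iff.mp
    ((Riordan.commutator_level_le n).trans (Riordan.level_antitone (Nat.le_succ n)))

theorem Riordan.mul_inv_mem_level {n : ℕ} {x y : Riordan K} :
    x * y⁻¹ ∈ Riordan.level K n ↔ x.left * y.left⁻¹ ∈ HSeries.level K n ∧
      x.right.unop * y.right.unop⁻¹ ∈ Nottingham.depth K n := by
  rw [(Riordan.level_normal n).mem_comm_iff, ← div_eq_mul_inv]
  exact Riordan.inv_mul_mem_sub

variable (K) in
theorem Riordan.isFiltration : IsFiltration (Riordan.level K) where
  normal n := inferInstance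
  antitone := Riordan.level_antitone
  isOpen_coset n g := by
    simp_rw [Riordan.mul_inv_mem_level]
    exact isOpen_induced_iff.mpr ⟨_, ((HSeries.isFiltration K).isOpen_coset n g.left).prod
      ((Nottingham.isFiltration K).isOpen_coset n g.right.unop), rfl⟩
  basis V hV g hg := by
    obtain ⟨W, hW, rfl⟩ := isOpen_induced_iff.mp hV
    obtain ⟨W₁, W₂, hW₁, hW₂, hg₁, hg₂, hW'⟩ := isOpen_prod_iff.mp hW _ _ hg
    obtain ⟨n₁, hn₁⟩ := (HSeries.isFiltration K).basis _ hW₁ _ hg₁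
    obtain ⟨n₂, hn₂⟩ := (Nottingham.isFiltration K).basis _ hW₂ _ hg₂
    refine ⟨max n₁ n₂, fun x hx => hW' ?_⟩
    rw [Riordan.mul_inv_mem_level] at hx
    exact ⟨hn₁ _ (HSeries.level_antitone (le_max_left _ _) hx.1),
      hn₂ _ (Nottingham.depth_antitone (le_max_right _ _) hx.2)⟩
  separated x hx := SemidirectProduct.ext
    ((HSeries.isFiltration K).separated _ fun n => (hx n).1)
    (MulOpposite.unop_injective ((Nottingham.isFiltration K).separated _ fun n => (hx n).2))
  complete a ha := by
    simp_rw [Riordan.mul_inv_mem_level] at ha ⊢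
    obtain ⟨h, hh⟩ := (HSeries.isFiltration K).complete (fun n => (a n).left)
      fun n => (ha n).1
    obtain ⟨g, hg⟩ := (Nottingham.isFiltration K).complete (fun n => (a n).right.unop)
      fun n => (ha n).2
    exact ⟨Riordan.mk h g, fun n => ⟨hh n, hg n⟩⟩

end SemidirectSubgroups

/-! ### Finiteness of the quotients. -/

section Counting

theorem card_quotient_le {G : Type*} [Group G] {N : Subgroup G} {T : Type*} (c : G → T)
    (h : ∀ x y, c x = c y → x⁻¹ * y ∈ N) : ENat.card (G ⧸ N) ≤ ENat.card T := by
  refine ENat.card_le_card_of_injective (f := fun q : G ⧸ N => c q.out) fun q q' hq => ?_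
  rw [← q.out_eq', ← q'.out_eq']
  exact QuotientGroup.eq.mpr (h _ _ hq)

theorem finite_quotient {G : Type*} [Group G] {N : Subgroup G} {T : Type*} [Finite T] (c : G → T)
    (h : ∀ x y, c x = c y → x⁻¹ * y ∈ N) : Finite (G ⧸ N) := by
  rw [← ENat.card_lt_top]
  exact (card_quotient_le c h).trans_lt (ENat.card_lt_top_of_finite)

variable {K : Type u} [CommRing K]

theorem X_pow_dvd_sub_of_coeff {m n : ℕ} {f g : K⟦X⟧} (hm : (X : K⟦X⟧) ^ m ∣ g - f)
    (h : (fun i : Fin n => coeff (m + i) f) = fun i : Fin n => coeff (m + i) g) :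
    (X : K⟦X⟧) ^ (m + n) ∣ g - f := by
  rw [X_pow_dvd_iff] at hm ⊢
  intro i hi
  rcases lt_or_ge i m with h1 | h1
  · exact hm i h1
  · have := congrFun h ⟨i - m, by omega⟩
    simp only [Nat.add_sub_cancel' h1] at this
    rw [map_sub, this, sub_self]

theorem HSeries.finite_quotient_level [Finite K] (n : ℕ) :
    Finite (HSeries K ⧸ HSeries.level K n) := by
  refine finite_quotient (fun h (i : Fin n) => coeff (0 + i) h.ser) fun x y hxy => ?_
  rw [mul_comm, ← div_eq_mul_inv, HSeries.div_mem_level, ← zero_add n]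
  exact X_pow_dvd_sub_of_coeff (by simp) hxy

theorem Nottingham.finite_quotient_depth [Finite K] (n : ℕ) :
    Finite (Nottingham K ⧸ Nottingham.depth K n) := by
  refine finite_quotient (fun h (i : Fin (n + 1)) => coeff (0 + i) h.ser) fun x y hxy => ?_
  rw [(Nottingham.depth_normal n).mem_comm_iff, Nottingham.mul_inv_mem_depth, ← zero_add (n + 1)]
  exact X_pow_dvd_sub_of_coeff (by simp) hxy

theorem Riordan.finite_quotient_level [Finite K] (n : ℕ) :
    Finite (Riordan K ⧸ Riordan.level K n) := by
  refine finite_quotient (fun r => ((fun i : Fin n => coeff (0 + i) r.left.ser),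
    (fun i : Fin (n + 1) => coeff (0 + i) r.right.unop.ser))) fun x y hxy => ?_
  rw [Prod.mk.injEq] at hxy
  rw [Riordan.level, Riordan.inv_mul_mem_sub, HSeries.div_mem_level, Nottingham.mul_inv_mem_depth]
  refine ⟨?_, ?_⟩
  · rw [← zero_add n]
    exact X_pow_dvd_sub_of_coeff (by simp) hxy.1
  · rw [← zero_add (n + 1)]
    exact X_pow_dvd_sub_of_coeff (by simp) hxy.2

theorem Riordan.isProfinite [Finite K] : IsProfinite (Riordan K) :=
  (Riordan.isFiltration K).isPro _ Riordan.finite_quotient_level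

theorem HSeries.compactSpace [Finite K] : CompactSpace (HSeries K) :=
  (HSeries.isFiltration K).compactSpace HSeries.finite_quotient_level

theorem Nottingham.compactSpace [Finite K] : CompactSpace (Nottingham K) :=
  (Nottingham.isFiltration K).compactSpace Nottingham.finite_quotient_depth

end Counting

/-! ### The Riordan group in characteristic `p` -/

section ProP

variable {K : Type u} [CommRing K]

theorem HSeries.pow_mem_level {s : ℕ} (hs : 1 ≤ s) {h : HSeries K} (hh : h ∈ HSeries.level K s)
    (n : ℕ) : (X : K⟦X⟧) ^ (s + 1) ∣ (h ^ n).ser - 1 - (n : K⟦X⟧) * (h.ser - 1) := by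
  rw [HSeries.mem_level] at hh
  induction n with
  | zero => simp [HSeries.ser_one]
  | succ n ih =>
    have h1 : (X : K⟦X⟧) ^ (s + 1) ∣ (h.ser - 1) * (h.ser - 1) := by
      refine X_pow_dvd_of_le (by omega : s + 1 ≤ s + s) ?_
      rw [pow_add]; exact mul_dvd_mul hh hh
    rw [pow_succ h, HSeries.ser_mul]
    convert (ih.mul_right h.ser).add (h1.mul_left (n : K⟦X⟧)) using 1
    push_cast
    ring

theorem Nottingham.HasLead.pow {m : ℕ} {τ : K} {f : Nottingham K} (hf : f.HasLead m τ) (n : ℕ) :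
    (f ^ n).HasLead m (n * τ) := by
  induction n with
  | zero => simpa using Nottingham.HasLead.one m
  | succ n ih =>
    rw [pow_succ]
    convert ih.mul hf using 1
    push_cast; ring

theorem HSeries.level_pow_char {p : ℕ} [CharP K p] {s : ℕ} (hs : 1 ≤ s) {h : HSeries K}
    (hh : h ∈ HSeries.level K s) : h ^ p ∈ HSeries.level K (s + 1) := by
  have h2 := HSeries.pow_mem_level hs hh p
  have : (p : K⟦X⟧) = 0 := by
    rw [← map_natCast (C (R := K)) p, CharP.cast_eq_zero, map_zero]
  rwa [this, zero_mul, sub_zero] at h2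

theorem Nottingham.depth_pow_char {p : ℕ} [CharP K p] {s : ℕ} {g : Nottingham K}
    (hg : g ∈ Nottingham.depth K s) : g ^ p ∈ Nottingham.depth K (s + 1) := by
  have h := (Nottingham.exists_hasLead hg).pow p
  rw [CharP.cast_eq_zero, zero_mul] at h
  exact h.mem_depth_succ

theorem Riordan.right_pow (r : Riordan K) (k : ℕ) : (r ^ k).right.unop = r.right.unop ^ k := by
  rw [← MulOpposite.unop_pow]
  exact congrArg MulOpposite.unop (map_pow SemidirectProduct.rightHom r k)

/-- The first component of r^k is a product of k substitutes of that of r, each of which agrees with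
it modulo the next level. -/
theorem Riordan.left_pow_div_mem {n : ℕ} {r : Riordan K}
    (hr : r ∈ Riordan.level K n) (k : ℕ) :
    (r ^ k).left / r.left ^ k ∈ HSeries.level K (n + 1) := by
  induction k with
  | zero => simp [one_mem]
  | succ k ih =>
    have h1 := HSeries.comp_div_mem_level_succ hr.1 (r ^ k).right.unop
    have h2 : (r ^ (k + 1)).left = (r ^ k).left * r.left.comp (r ^ k).right.unop := by
      rw [pow_succ]; rfl
    rw [h2, pow_succ, mul_div_mul_comm]
    exact mul_mem ih h1

theorem Riordan.pow_mem_level {p : ℕ} [CharP K p] {n : ℕ} (hn : 1 ≤ n) {r : Riordan K}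
    (hr : r ∈ Riordan.level K n) : r ^ p ∈ Riordan.level K (n + 1) := by
  constructor
  · have := mul_mem (Riordan.left_pow_div_mem hr p) (HSeries.level_pow_char (p := p) hn hr.1)
    rwa [div_mul_cancel] at this
  · rw [Riordan.right_pow]
    exact Nottingham.depth_pow_char hr.2

theorem Riordan.pow_pow_mem_level {p : ℕ} [CharP K p] (r : Riordan K) (n : ℕ) :
    r ^ p ^ n ∈ Riordan.level K (n + 1) := by
  induction n with
  | zero =>
    refine ⟨?_, ?_⟩
    · rw [HSeries.level_one]; trivial
    · rw [Nottingham.depth_one]; trivial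
  | succ n ih =>
    rw [pow_succ, pow_mul]
    exact Riordan.pow_mem_level (by omega) ih

theorem Riordan.isProP [Finite K] (p : ℕ) [Fact p.Prime] [CharP K p] : IsProP p (Riordan K) := by
  refine (Riordan.isFiltration K).isPro _ fun n => ⟨Riordan.finite_quotient_level n, ?_⟩
  have := Riordan.finite_quotient_level (K := K) n
  refine IsPGroup.iff_card.mp fun q => ⟨n, ?_⟩
  induction q using QuotientGroup.induction_on with
  | H r =>
    rw [← QuotientGroup.mk_pow, QuotientGroup.eq_one_iff]
    exact Riordan.level_antitone (Nat.le_succ n) (Riordan.pow_pow_mem_level r n)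

theorem Riordan.infinite [Nontrivial K] : Infinite (Riordan K) := by
  refine Infinite.of_injective (fun n : ℕ => (Riordan.mk ⟨1 + X ^ (n + 1), by simp⟩ 1 : Riordan K))
    fun m n h => ?_
  have h1 : (1 + X ^ (m + 1) : K⟦X⟧) = 1 + X ^ (n + 1) :=
    congrArg (fun r : Riordan K => r.left.ser) h
  have h2 := congrArg (coeff (m + 1)) (add_left_cancel h1)
  rw [coeff_X_pow, coeff_X_pow, if_pos rfl] at h2
  by_contra hne
  rw [if_neg (by omega)] at h2
  exact one_ne_zero h2

end ProP

end RiordanGroup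

namespace RiordanGroup

/-! ### Explicit commutators with x + x^2 and x + x^3 in N(K). -/

section Computations

variable {K : Type u} [CommRing K]

/-- A binomial expansion with explicit remainder, valid without division, so that the coefficients
remain integers when K = ℤ. -/
theorem exists_one_add_pow {R : Type*} [CommRing R] (y : R) (n : ℕ) :
    ∃ e, (1 + y) ^ n = 1 + n * y + n.choose 2 * y ^ 2 + n.choose 3 * y ^ 3 + y ^ 4 * e := by
  induction n with
  | zero => exact ⟨0, by simp⟩
  | succ n ih =>
    obtain ⟨e, he⟩ := ih
    refine ⟨e * (1 + y) + n.choose 3, ?_⟩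
    rw [pow_succ, he]
    simp only [Nat.choose_succ_succ n 1, Nat.choose_succ_succ n 2, Nat.choose_one_right]
    push_cast
    ring

theorem two_mul_choose_two (n : ℕ) : (2 : ℤ) * n.choose 2 = n * (n - 1) := by
  induction n with
  | zero => simp
  | succ n ih =>
    rw [Nat.choose_succ_succ n 1, Nat.choose_one_right]
    push_cast
    linear_combination ih

theorem six_mul_choose_three (n : ℕ) : (6 : ℤ) * n.choose 3 = n * (n - 1) * (n - 2) := by
  induction n with
  | zero => simp
  | succ n ih =>
    rw [Nat.choose_succ_succ n 2]
    push_cast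
    linear_combination ih + 3 * two_mul_choose_two n

/-- The element `x + v` of `N(K)`. -/
noncomputable def Nottingham.addX (v : K⟦X⟧) (hv : (X : K⟦X⟧) ^ 2 ∣ v) : Nottingham K :=
  ⟨X + v, by rw [map_add, constantCoeff_X, ← coeff_zero_eq_constantCoeff_apply,
      X_pow_dvd_iff.mp hv 0 (by omega), add_zero], by
    rw [map_add, coeff_one_X, X_pow_dvd_iff.mp hv 1 (by omega), add_zero]⟩

theorem Nottingham.addX_ser_sub_X (v : K⟦X⟧) (hv : (X : K⟦X⟧) ^ 2 ∣ v) :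
    (Nottingham.addX v hv).ser - X = v := add_sub_cancel_left _ _

theorem subst_C_mul_X_pow (c : K) (n : ℕ) (f : Nottingham K) :
    (C c * X ^ n : K⟦X⟧).subst f.ser = C c * f.ser ^ n := by
  rw [subst_mul f.hasSubst, subst_pow f.hasSubst, subst_X f.hasSubst, subst_C]
  rfl

variable (K) in
/-- The element `x + x^n` of `N(K)`, for `n ≥ 2`. -/
noncomputable def Nottingham.xAddPow (n : ℕ) (hn : 2 ≤ n) : Nottingham K :=
  Nottingham.addX (X ^ n) (pow_dvd_pow _ hn)

theorem Nottingham.xAddPow_ser (n : ℕ) (hn : 2 ≤ n) :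
    (Nottingham.xAddPow K n hn).ser = X + X ^ n := rfl

theorem Nottingham.xAddPow_mul_ser (n : ℕ) (hn : 2 ≤ n) (g : Nottingham K) :
    (Nottingham.xAddPow K n hn * g).ser = g.ser + g.ser ^ n := by
  rw [Nottingham.ser_mul, Nottingham.xAddPow_ser, subst_add g.hasSubst, subst_pow g.hasSubst,
    subst_X g.hasSubst]

theorem Nottingham.mul_ser_eq (g f : Nottingham K) :
    (g * f).ser = f.ser + (g.ser - X).subst f.ser := by
  rw [subst_sub f.hasSubst, subst_X f.hasSubst, Nottingham.ser_mul]
  ring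

/-- With v = g - x and f = x + x^2, one has f(g) - g(f) = v + 2xv + v^2 - v(x + x^2). The condition
n ≥ 4 puts v^2, of order at least 2n, into the error term; the rest is the expansion of (1 + x)^n
and (1 + x)^(n+1). -/
theorem X_pow_dvd_xAddPow_two {n : ℕ} (hn : 4 ≤ n) (α β : K) {g : Nottingham K}
    (hg : g.ser - X = C α * X ^ n + C β * X ^ (n + 1)) :
    (X : K⟦X⟧) ^ (n + 4) ∣ (Nottingham.xAddPow K 2 le_rfl * g).ser -
      (g * Nottingham.xAddPow K 2 le_rfl).ser - (C (α * (2 - n)) * X ^ (n + 1) +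
        C (β * (1 - n) - α * n.choose 2) * X ^ (n + 2) +
        C (-(α * n.choose 3 + β * (n + 1).choose 2)) * X ^ (n + 3)) := by
  rw [Nottingham.xAddPow_mul_ser, Nottingham.mul_ser_eq, hg, subst_add (Nottingham.hasSubst _),
    subst_C_mul_X_pow, subst_C_mul_X_pow, Nottingham.xAddPow_ser]
  obtain ⟨e₁, h₁⟩ := exists_one_add_pow (X : K⟦X⟧) n
  obtain ⟨e₂, h₂⟩ := exists_one_add_pow (X : K⟦X⟧) (n + 1)
  have hX : (X + X ^ 2 : K⟦X⟧) = X * (1 + X) := by ring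
  have hg' : g.ser = X + (C α * X ^ n + C β * X ^ (n + 1)) := by rw [← hg]; ring
  rw [hX, mul_pow, mul_pow, h₁, h₂, hg']
  simp only [map_sub, map_mul, map_add, map_neg, map_natCast, map_one, map_ofNat]
  obtain ⟨j, rfl⟩ := Nat.exists_eq_add_of_le hn
  refine ⟨X ^ j * (C α + C β * X) ^ 2 - C α * e₁ -
    C β * ((((4 + j + 1).choose 3 : ℕ) : K⟦X⟧) + X * e₂), ?_⟩
  push_cast
  ring

/-- With v = g - x, the terms 3xv^2 and v^3 of (x + v)^3 are negligible because n ≥ 4. What remains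
involves powers of 1 + x^2, so the contributions of γ and δ do not mix up to the stated order. -/
theorem X_pow_dvd_xAddPow_three {n : ℕ} (hn : 4 ≤ n) (γ δ : K) {g : Nottingham K}
    (hg : g.ser - X = C γ * X ^ n + C δ * X ^ (n + 1)) :
    (X : K⟦X⟧) ^ (n + 5) ∣ (Nottingham.xAddPow K 3 (by omega) * g).ser -
      (g * Nottingham.xAddPow K 3 (by omega)).ser - (C (γ * (3 - n)) * X ^ (n + 2) +
        C (δ * (2 - n)) * X ^ (n + 3) + C (-(γ * n.choose 2)) * X ^ (n + 4)) := by
  rw [Nottingham.xAddPow_mul_ser, Nottingham.mul_ser_eq, hg, subst_add (Nottingham.hasSubst _),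
    subst_C_mul_X_pow, subst_C_mul_X_pow, Nottingham.xAddPow_ser]
  obtain ⟨e₁, h₁⟩ := exists_one_add_pow (X ^ 2 : K⟦X⟧) n
  obtain ⟨e₂, h₂⟩ := exists_one_add_pow (X ^ 2 : K⟦X⟧) (n + 1)
  have hX : (X + X ^ 3 : K⟦X⟧) = X * (1 + X ^ 2) := by ring
  have hg' : g.ser = X + (C γ * X ^ n + C δ * X ^ (n + 1)) := by rw [← hg]; ring
  rw [hX, mul_pow, mul_pow, h₁, h₂, hg']
  simp only [map_sub, map_mul, map_neg, map_natCast, map_ofNat]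
  obtain ⟨j, rfl⟩ := Nat.exists_eq_add_of_le hn
  refine ⟨3 * X ^ j * (C γ + C δ * X) ^ 2 + X ^ (2 * j + 3) * (C γ + C δ * X) ^ 3
    - C γ * (X * (((4 + j).choose 3 : ℕ) : K⟦X⟧) + X ^ 3 * e₁) -
    C δ * ((((4 + j + 1).choose 2 : ℕ) : K⟦X⟧) + X ^ 2 * (((4 + j + 1).choose 3 : ℕ) : K⟦X⟧) + X ^ 4 * e₂), ?_⟩
  push_cast
  ring

theorem Nottingham.hasLead_commutator_xAddPow_two {m : ℕ} (hm : 2 ≤ m) (t : K) {g : Nottingham K}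
    (hg : g.ser - X = C t * X ^ m) :
    ⁅Nottingham.xAddPow K 2 le_rfl, g⁆.HasLead m (t * (2 - m)) := by
  obtain ⟨r, rfl⟩ := Nat.exists_eq_add_of_le hm
  have h := X_pow_dvd_comp_sub_comp (r := r + 1) (by omega) (Nottingham.xAddPow K 2 le_rfl) g
    (by rw [hg, add_comm 2 r]; exact Dvd.intro_left _ rfl)
  refine Nottingham.HasLead.commutator ?_
  rw [hg, Nottingham.xAddPow_ser] at h
  rw [show 2 + r + 2 = r + 1 + 3 by ring]
  convert h using 2
  simp [coeff_X]
  ring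

theorem Nottingham.hasLead_commutator_xAddPow_three {n : ℕ} (hn : 2 ≤ n) (t : K) {g : Nottingham K}
    (hg : g.ser - X = C t * X ^ n) :
    ⁅Nottingham.xAddPow K 3 (by omega), g⁆.HasLead (n + 1) (t * (3 - n)) := by
  refine Nottingham.HasLead.commutator ?_
  rw [Nottingham.xAddPow_mul_ser, Nottingham.mul_ser_eq, hg, subst_C_mul_X_pow,
    Nottingham.xAddPow_ser]
  obtain ⟨e₁, h₁⟩ := exists_one_add_pow (X ^ 2 : K⟦X⟧) n
  have hX : (X + X ^ 3 : K⟦X⟧) = X * (1 + X ^ 2) := by ring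
  have hg' : g.ser = X + C t * X ^ n := by rw [← hg]; ring
  rw [hX, mul_pow, h₁, hg']
  simp only [map_sub, map_mul, map_natCast, map_ofNat]
  obtain ⟨j, rfl⟩ := Nat.exists_eq_add_of_le hn
  refine ⟨3 * X ^ j * (C t) ^ 2 + X ^ (2 * j + 1) * (C t) ^ 3
    - C t * (X * (((2 + j).choose 2 : ℕ) : K⟦X⟧) + X ^ 3 * (((2 + j).choose 3 : ℕ) : K⟦X⟧) + X ^ 5 * e₁), ?_⟩
  push_cast
  ring

/-- The commutator `(g ∘ f)⁻¹ (f ∘ g)` to higher order. -/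
theorem Nottingham.inv_mul_ser_sub {a b N : ℕ} (ha : 1 ≤ a) (hN : N ≤ 2 * a) (hN' : N ≤ a + b)
    {f g : Nottingham K} (hg : (X : K⟦X⟧) ^ b ∣ d⁄dX K g.ser - 1) {Y : K⟦X⟧}
    (hu : (X : K⟦X⟧) ^ a ∣ (f * g).ser - (g * f).ser)
    (h : (X : K⟦X⟧) ^ N ∣ (f * g).ser - (g * f).ser - d⁄dX K f.ser * Y) :
    (X : K⟦X⟧) ^ N ∣ ((g * f)⁻¹ * (f * g)).ser - X - Y := by
  obtain ⟨r, rfl⟩ := Nat.exists_eq_add_of_le ha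
  have hz : (g * f)⁻¹ * (f * g) ∈ Nottingham.depth K r := by
    rw [(Nottingham.depth_normal r).mem_comm_iff, Nottingham.mul_inv_mem_depth, add_comm r]
    exact hu
  rw [Nottingham.mem_depth, add_comm r] at hz
  set z := (g * f)⁻¹ * (f * g) with hzdef
  -- Since (gf)z = fg, Taylor expansion gives fg - gf ≡ (gf)'(z - x). As g' ≡ 1, the factor (gf)'
  -- may be replaced by f', a unit that is cancelled at the end.
  have h1 := taylor_subst ha (g * f).ser constantCoeff_X hz
  rw [X_subst, X_subst, add_sub_cancel, ← Nottingham.ser_mul, hzdef, mul_inv_cancel_left,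
    ← hzdef] at h1
  have h2 : (X : K⟦X⟧) ^ N ∣ (d⁄dX K (g * f).ser - d⁄dX K f.ser) * (z.ser - X) := by
    refine X_pow_dvd_of_le hN' ?_
    rw [add_comm, pow_add]
    refine mul_dvd_mul ?_ hz
    rw [Nottingham.ser_mul, derivative_subst f.hasSubst, ← sub_one_mul]
    refine Dvd.dvd.mul_right ?_ _
    have h3 := X_pow_dvd_subst f.constCoeff_ser hg
    rw [subst_sub f.hasSubst] at h3
    have h4 : (1 : K⟦X⟧).subst f.ser = 1 := by
      rw [← coe_substAlgHom f.hasSubst, map_one]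
    rwa [h4] at h3
  have h5 : (X : K⟦X⟧) ^ N ∣ d⁄dX K f.ser * (z.ser - X - Y) := by
    convert (h.sub (X_pow_dvd_of_le hN h1)).sub h2 using 1
    ring
  rwa [f.isUnit_derivative.dvd_mul_left] at h5

theorem Nottingham.inv_mul_mem_commutator (f g : Nottingham K) :
    (g * f)⁻¹ * (f * g) ∈ ⁅(⊤ : Subgroup (Nottingham K)), (⊤ : Subgroup (Nottingham K))⁆ := by
  have : (g * f)⁻¹ * (f * g) = ⁅f⁻¹, g⁻¹⁆ := by rw [commutatorElement_def]; group
  rw [this]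
  exact Subgroup.commutator_mem_commutator trivial trivial

theorem X_pow_dvd_derivative_addX {n b : ℕ} (hb : b + 1 ≤ n) {α β : K} {g : Nottingham K}
    (hg : g.ser - X = C α * X ^ n + C β * X ^ (n + 1)) :
    (X : K⟦X⟧) ^ b ∣ d⁄dX K g.ser - 1 := by
  have h : (X : K⟦X⟧) ^ (b + 1) ∣ g.ser - X := by
    rw [hg]
    exact ((pow_dvd_pow _ hb).mul_left _).add ((pow_dvd_pow _ (by omega)).mul_left _)
  simpa using X_pow_dvd_derivative h

/-- A product of two commutators to higher order. -/
theorem Nottingham.exists_commutator_hasLead {n : ℕ} (hn : 5 ≤ n) {α β γ δ : K}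
    (hA : α * (2 - n) + γ * (4 - n) = 0)
    (hB : β * (1 - n) - α * n.choose 2 - 2 * (α * (2 - n)) + δ * (3 - n) = 0) :
    ∃ z ∈ ⁅(⊤ : Subgroup (Nottingham K)), (⊤ : Subgroup (Nottingham K))⁆,
      z.HasLead (n + 2) (-(α * n.choose 3 + β * (n + 1).choose 2) + 2 * (δ * (3 - n)) -
      γ * (n - 1).choose 2 - 3 * (γ * (4 - n))) := by
  obtain ⟨n', hn'⟩ : ∃ n', n = n' + 1 := ⟨n - 1, by omega⟩
  obtain ⟨g₁, hg₁⟩ : ∃ g : Nottingham K, g.ser - X = C α * X ^ n + C β * X ^ (n + 1) :=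
    ⟨_, Nottingham.addX_ser_sub_X _ (((pow_dvd_pow _ (by omega)).mul_left _).add
      ((pow_dvd_pow _ (by omega)).mul_left _))⟩
  obtain ⟨g₂, hg₂⟩ : ∃ g : Nottingham K, g.ser - X = C γ * X ^ n' + C δ * X ^ (n' + 1) :=
    ⟨_, Nottingham.addX_ser_sub_X _ (((pow_dvd_pow _ (by omega)).mul_left _).add
      ((pow_dvd_pow _ (by omega)).mul_left _))⟩
  have h₁ := X_pow_dvd_xAddPow_two (by omega) _ _ hg₁
  have h₂ := X_pow_dvd_xAddPow_three (by omega) _ _ hg₂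
  have hd₁ : (X : K⟦X⟧) ^ (n - 1) ∣ d⁄dX K g₁.ser - 1 :=
    X_pow_dvd_derivative_addX (by omega) hg₁
  have hd₂ : (X : K⟦X⟧) ^ (n - 2) ∣ d⁄dX K g₂.ser - 1 :=
    X_pow_dvd_derivative_addX (by omega) hg₂
  have df₁ : d⁄dX K (Nottingham.xAddPow K 2 le_rfl).ser = 1 + 2 * X := by
    rw [Nottingham.xAddPow_ser]; simp
  have df₂ : d⁄dX K (Nottingham.xAddPow K 3 (by omega)).ser = 1 + 3 * X ^ 2 := by
    rw [Nottingham.xAddPow_ser]; simp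
  generalize Nottingham.xAddPow K 2 le_rfl = f₁ at h₁ df₁
  generalize Nottingham.xAddPow K 3 (by omega) = f₂ at h₂ df₂
  have hn'K : (n' : K) = n - 1 := by rw [hn']; push_cast; ring
  rw [show n' + 5 = n + 4 by omega, show n' + 2 = n + 1 by omega, show n' + 3 = n + 2 by omega,
    show n' + 4 = n + 3 by omega, hn'K, show (3 : K) - (n - 1) = 4 - n by ring,
    show (2 : K) - (n - 1) = 3 - n by ring] at h₂
  rw [show n - 1 = n' by omega] at hd₁ ⊢
  have dvdY : ∀ a b c : K, (X : K⟦X⟧) ^ (n + 1) ∣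
      C a * X ^ (n + 1) + C b * X ^ (n + 2) + C c * X ^ (n + 3) := fun a b c =>
    (((pow_dvd_pow _ (by omega)).mul_left _).add ((pow_dvd_pow _ (by omega)).mul_left _)).add
      ((pow_dvd_pow _ (by omega)).mul_left _)
  have dvdY' : ∀ {a b c : K} {w : K⟦X⟧},
      (X : K⟦X⟧) ^ (n + 4) ∣ w - (C a * X ^ (n + 1) + C b * X ^ (n + 2) + C c * X ^ (n + 3)) →
      (X : K⟦X⟧) ^ (n + 1) ∣ w := by
    intro a b c w hw
    have := (X_pow_dvd_of_le (by omega : n + 1 ≤ n + 4) hw).add (dvdY a b c)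
    rwa [sub_add_cancel] at this
  generalize hA₁ : α * (2 - (n : K)) = A₁ at *
  generalize hA₂ : γ * (4 - (n : K)) = A₂ at *
  generalize hB₁ : β * (1 - (n : K)) - α * n.choose 2 = B₁ at *
  generalize hB₂ : δ * (3 - (n : K)) = B₂ at *
  generalize hD₁ : -(α * (n.choose 3 : K) + β * (n + 1).choose 2) = D₁ at *
  generalize hD₂ : γ * (n'.choose 2 : K) = D₂ at *
  -- Y is the expansion of fg - gf divided by f₁' = 1 + 2x, truncated at x^(n+4).
  have hz₁ := Nottingham.inv_mul_ser_sub (a := n + 1) (N := n + 4) (by omega) (by omega)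
    (by omega) (f := f₁) hd₁
    (Y := C A₁ * X ^ (n + 1) + C (B₁ - 2 * A₁) * X ^ (n + 2) +
      C (D₁ - 2 * (B₁ - 2 * A₁)) * X ^ (n + 3)) (dvdY' h₁)
    (by
      rw [df₁]
      convert h₁.sub (Dvd.intro (2 * C (D₁ - 2 * (B₁ - 2 * A₁))) rfl :
        (X : K⟦X⟧) ^ (n + 4) ∣ X ^ (n + 4) * (2 * C (D₁ - 2 * (B₁ - 2 * A₁)))) using 1
      simp only [map_sub, map_mul, map_ofNat]
      ring)
  -- The same division, now by f₂' = 1 + 3x^2.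
  have hz₂ := Nottingham.inv_mul_ser_sub (a := n + 1) (N := n + 4) (by omega) (by omega)
    (by omega) (f := f₂) hd₂
    (Y := C A₂ * X ^ (n + 1) + C B₂ * X ^ (n + 2) + C (-D₂ - 3 * A₂) * X ^ (n + 3)) (dvdY' h₂)
    (by
      rw [df₂]
      convert h₂.sub (Dvd.intro (3 * (C B₂ + C (-D₂ - 3 * A₂) * X)) rfl :
        (X : K⟦X⟧) ^ (n + 4) ∣ X ^ (n + 4) * (3 * (C B₂ + C (-D₂ - 3 * A₂) * X))) using 1
      simp only [map_sub, map_mul, map_neg, map_ofNat]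
      ring)
  refine ⟨_, mul_mem (Nottingham.inv_mul_mem_commutator f₁ g₁)
    (Nottingham.inv_mul_mem_commutator f₂ g₂), ?_⟩
  generalize (g₁ * f₁)⁻¹ * (f₁ * g₁) = z₁ at hz₁
  generalize (g₂ * f₂)⁻¹ * (f₂ * g₂) = z₂ at hz₂
  have hz₁' := dvdY' hz₁
  have hz₂' := dvdY' hz₂
  -- Up to this order, composing z₁ and z₂ amounts to adding z₁ - x and z₂ - x.
  have h12 : (X : K⟦X⟧) ^ (n + 4) ∣ (z₁.ser - X).subst z₂.ser - (z₁.ser - X) := by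
    have t := X_pow_dvd_of_le (by omega : n + 4 ≤ 2 * (n + 1))
      (taylor_subst (by omega) (z₁.ser - X) constantCoeff_X hz₂')
    rw [X_subst, X_subst, add_sub_cancel] at t
    have t2 : (X : K⟦X⟧) ^ (n + 4) ∣ d⁄dX K (z₁.ser - X) * (z₂.ser - X) := by
      refine X_pow_dvd_of_le (by omega : n + 4 ≤ n + (n + 1)) ?_
      rw [pow_add]
      exact mul_dvd_mul (X_pow_dvd_derivative hz₁') hz₂'
    have := t.add t2
    rwa [sub_add_cancel] at this
  rw [Nottingham.HasLead, Nottingham.ser_mul_sub_X]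
  convert (h12.add hz₁).add hz₂ using 1
  -- `hA` and `hB` say that the coefficients of x^(n+1) and x^(n+2) cancel, so the term in x^(n+3)
  -- leads.
  have hA' := congrArg (C (R := K)) hA
  have hB' := congrArg (C (R := K)) hB
  simp only [map_sub, map_mul, map_neg, map_ofNat, map_add, map_zero] at hA' hB' ⊢
  linear_combination (X ^ (n + 1)) * hA' + (X ^ (n + 2) - 2 * X ^ (n + 3)) * hB'

/-- In every even depth, a product of two commutators has an odd leading coefficient. -/
theorem Nottingham.exists_odd_hasLead {k : ℕ} (hk : 3 ≤ k) : ∃ T : ℤ, Odd T ∧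
    ∃ z ∈ ⁅(⊤ : Subgroup (Nottingham K)), (⊤ : Subgroup (Nottingham K))⁆,
      z.HasLead (2 * k + 2) (T : K) := by
  have hc2 : ((2 * k).choose 2 : ℤ) = k * (2 * k - 1) := by
    have := two_mul_choose_two (2 * k)
    push_cast at this
    linarith
  have hc2' : ((2 * k + 1).choose 2 : ℤ) = k * (2 * k + 1) := by
    have := two_mul_choose_two (2 * k + 1)
    push_cast at this
    linarith
  have hc2'' : ((2 * k - 1).choose 2 : ℤ) = (k - 1) * (2 * k - 1) := by
    have := two_mul_choose_two (2 * k - 1)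
    rw [Nat.cast_sub (by omega)] at this
    push_cast at this
    linarith
  have hc3 : Even ((2 * k).choose 3 : ℤ) := by
    have h := six_mul_choose_three (2 * k)
    have h2 : (3 : ℤ) * (2 * k).choose 3 = 2 * (k * (2 * k - 1) * (k - 1)) := by
      push_cast at h
      linarith
    have : Even ((3 : ℤ) * (2 * k).choose 3) := by rw [h2]; exact even_two_mul _
    rw [Int.even_mul] at this
    exact this.resolve_left (by decide)
  -- Take n = 2k. The choice of α, γ cancels the first term. For the second, R is the amount to be
  -- compensated by β(1 - n) + δ(3 - n), and (k - 2)(1 - 2k) + (1 - k)(3 - 2k) = 1 supplies β and δ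
  -- over ℤ.
  obtain ⟨α, hα⟩ : ∃ α : ℤ, α = 2 - k := ⟨_, rfl⟩
  obtain ⟨γ, hγ⟩ : ∃ γ : ℤ, γ = k - 1 := ⟨_, rfl⟩
  obtain ⟨R, hR⟩ : ∃ R : ℤ, R = α * (k * (2 * k - 1)) + 4 * (α * (1 - k)) := ⟨_, rfl⟩
  obtain ⟨β, hβ⟩ : ∃ β : ℤ, β = R * (k - 2) := ⟨_, rfl⟩
  obtain ⟨δ, hδ⟩ : ∃ δ : ℤ, δ = R * (1 - k) := ⟨_, rfl⟩
  have hA : (α : K) * (2 - (2 * k : ℕ)) + γ * (4 - (2 * k : ℕ)) = 0 := by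
    have : α * (2 - (2 * k : ℕ)) + γ * (4 - (2 * k : ℕ)) = 0 := by
      rw [hα, hγ]; push_cast; ring
    exact_mod_cast congrArg (Int.cast (R := K)) this
  have hB : (β : K) * (1 - (2 * k : ℕ)) - α * (2 * k).choose 2 - 2 * (α * (2 - (2 * k : ℕ))) +
      δ * (3 - (2 * k : ℕ)) = 0 := by
    have : β * (1 - (2 * k : ℕ)) - α * (2 * k).choose 2 - 2 * (α * (2 - (2 * k : ℕ))) +
        δ * (3 - (2 * k : ℕ)) = 0 := by
      rw [hc2, hβ, hδ, hR]; push_cast; ring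
    exact_mod_cast congrArg (Int.cast (R := K)) this
  obtain ⟨z, hz, hzl⟩ := Nottingham.exists_commutator_hasLead (by omega) hA hB
  refine ⟨-(α * (2 * k).choose 3 + β * (2 * k + 1).choose 2) + 2 * (δ * (3 - (2 * k : ℕ))) -
      γ * (2 * k - 1).choose 2 - 3 * (γ * (4 - (2 * k : ℕ))), ?_, z, hz, ?_⟩
  -- Modulo 2, the β-term contributes k, the γ-term contributes k - 1, and everything else is even.
  · rw [← Int.not_even_iff_odd, hc2', hc2'', hβ, hR, hα, hγ]
    have h1 : Even (1 : ℤ) ↔ False := by decide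
    have h2 : Even (2 : ℤ) ↔ True := by decide
    have h3 : Even (3 : ℤ) ↔ False := by decide
    have h4 : Even (4 : ℤ) ↔ True := by decide
    push_cast
    simp only [Int.even_add, Int.even_sub, Int.even_mul, even_neg, hc3, h1, h2, h3, h4]
    by_cases hk2 : Even (k : ℤ) <;> simp [hk2]
  · push_cast at hzl ⊢
    exact hzl

variable (K) in
/-- The integers that occur as coefficients of `x^(m+1)` in elements `x + τ x^(m+1) + ⋯` of a
subgroup of `N(K)`. -/
def Nottingham.leads (L : Subgroup (Nottingham K)) (m : ℕ) : AddSubgroup ℤ where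
  carrier := {τ | ∃ z ∈ L, z.HasLead m (τ : K)}
  add_mem' := by
    rintro a b ⟨z, hz, hza⟩ ⟨w, hw, hwb⟩
    exact ⟨z * w, mul_mem hz hw, by rw [Int.cast_add]; exact hza.mul hwb⟩
  zero_mem' := ⟨1, one_mem _, by rw [Int.cast_zero]; exact Nottingham.HasLead.one m⟩
  neg_mem' := by
    rintro a ⟨z, hz, hza⟩
    exact ⟨z⁻¹, inv_mem hz, by rw [Int.cast_neg]; exact hza.inv⟩

/-- The attainable leading coefficients form a subgroup of ℤ containing 2 - m and 4 - m, hence 2. An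
odd element is 2 - m for m odd and comes from `Nottingham.exists_odd_hasLead` for m = 2k + 2, whose
condition k ≥ 3 is the reason for the bound 8. -/
theorem Nottingham.leads_commutator {m : ℕ} (hm : 8 ≤ m) :
    Nottingham.leads K ⁅(⊤ : Subgroup (Nottingham K)), (⊤ : Subgroup (Nottingham K))⁆ m = ⊤ := by
  set L := Nottingham.leads K ⁅(⊤ : Subgroup (Nottingham K)), (⊤ : Subgroup (Nottingham K))⁆ m
  obtain ⟨g₁, hg₁⟩ : ∃ g : Nottingham K, g.ser - X = C 1 * X ^ m :=
    ⟨_, Nottingham.addX_ser_sub_X _ ((pow_dvd_pow _ (by omega)).mul_left _)⟩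
  obtain ⟨g₂, hg₂⟩ : ∃ g : Nottingham K, g.ser - X = C 1 * X ^ (m - 1) :=
    ⟨_, Nottingham.addX_ser_sub_X _ ((pow_dvd_pow _ (by omega)).mul_left _)⟩
  have h1 : (2 - m : ℤ) ∈ L := by
    have := Nottingham.hasLead_commutator_xAddPow_two (by omega) 1 hg₁
    refine ⟨_, Subgroup.commutator_mem_commutator (g₁ := Nottingham.xAddPow K 2 le_rfl) (g₂ := g₁)
      trivial trivial, ?_⟩
    rw [one_mul] at this
    push_cast
    exact this
  have h2 : (4 - m : ℤ) ∈ L := by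
    have := Nottingham.hasLead_commutator_xAddPow_three (by omega) 1 hg₂
    refine ⟨_, Subgroup.commutator_mem_commutator (g₁ := Nottingham.xAddPow K 3 (by omega))
      (g₂ := g₂) trivial trivial, ?_⟩
    rw [one_mul, Nat.cast_sub (by omega), show m - 1 + 1 = m by omega] at this
    push_cast at this ⊢
    convert this using 1
    ring
  have h3 : (2 : ℤ) ∈ L := by
    have := sub_mem h2 h1
    convert this using 1
    ring
  have h4 : (1 : ℤ) ∈ L := by
    rcases Nat.even_or_odd' m with ⟨l, rfl | rfl⟩
    · obtain ⟨k, rfl⟩ : ∃ k, l = k + 1 := ⟨l - 1, by omega⟩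
      obtain ⟨T, ⟨j, hj⟩, hT⟩ := Nottingham.exists_odd_hasLead (K := K) (k := k) (by omega)
      have := sub_mem (show T ∈ L from hT) (zsmul_mem h3 j)
      convert this using 1
      rw [hj, smul_eq_mul]; ring
    · have := add_mem h1 (zsmul_mem h3 l)
      convert this using 1
      rw [smul_eq_mul]; push_cast; ring
  rw [AddSubgroup.eq_top_iff']
  intro x
  simpa using zsmul_mem h4 x

end Computations

end RiordanGroup

namespace RiordanGroup

/-! ### Topological generators of N(K) and R(K). -/

section Generation

variable {K : Type u} [CommRing K]

/-- Modulo N the subgroup M is central, so the commutator of ml and m'l' agrees with that of l and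
l', which lies in L. -/
theorem commutator_le_of_central {G : Type*} [Group G] {L M N : Subgroup G} [N.Normal]
    (hM : ∀ g : G, ∀ m ∈ M, ⁅g, m⁆ ∈ N) (hL : ∀ g, ∃ l ∈ L, ∃ m ∈ M, g = m * l) :
    ⁅(⊤ : Subgroup G), (⊤ : Subgroup G)⁆ ≤ L ⊔ N := by
  rw [Subgroup.commutator_le]
  intro x _ y _
  obtain ⟨l, hl, m, hm, rfl⟩ := hL x
  obtain ⟨l', hl', m', hm', rfl⟩ := hL y
  have hc : ∀ g h : G, g * h⁻¹ ∈ N ↔ (QuotientGroup.mk' N g) = QuotientGroup.mk' N h := fun g h => by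
    rw [QuotientGroup.mk'_apply, QuotientGroup.mk'_apply, eq_comm, QuotientGroup.eq,
      (inferInstance : N.Normal).mem_comm_iff]
  have hcomm : ∀ g : G, ∀ m ∈ M, QuotientGroup.mk' N g * QuotientGroup.mk' N m =
      QuotientGroup.mk' N m * QuotientGroup.mk' N g := fun g m hm => by
    rw [← map_mul, ← map_mul, ← hc, ← commutatorElement_eq_mul_inv]
    exact hM g m hm
  have key : ⁅m * l, m' * l'⁆ * ⁅l, l'⁆⁻¹ ∈ N := by
    rw [hc]
    have e1 := fun g => hcomm g m hm
    have e2 := fun g => hcomm g m' hm'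
    have c1 : Commute (QuotientGroup.mk' N m) (QuotientGroup.mk' N l) := (e1 l).symm
    have c2 : Commute (QuotientGroup.mk' N m) (QuotientGroup.mk' N m') := (e1 m').symm
    have c3 : Commute (QuotientGroup.mk' N m) (QuotientGroup.mk' N l') := (e1 l').symm
    have c4 : Commute (QuotientGroup.mk' N m') (QuotientGroup.mk' N l) := (e2 l).symm
    have c5 : Commute (QuotientGroup.mk' N m') (QuotientGroup.mk' N l') := (e2 l').symm
    simp only [map_commutatorElement, map_mul]
    generalize QuotientGroup.mk' N m = a at *
    generalize QuotientGroup.mk' N m' = b at *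
    generalize QuotientGroup.mk' N l = x at *
    generalize QuotientGroup.mk' N l' = y at *
    rw [commutatorElement_eq_mul_inv, commutatorElement_eq_mul_inv]
    have h1 : a * x * (b * y) = a * b * (x * y) := by
      rw [mul_assoc, ← mul_assoc x, ← c4.eq]; group
    have h2 : b * y * (a * x) = a * b * (y * x) := by
      rw [mul_assoc, ← mul_assoc y, ← c3.eq, c2.eq]; group
    have h3 : Commute (a * b) (x * y * (y * x)⁻¹) := by
      refine Commute.mul_left ?_ ?_
      · exact (c1.mul_right c3).mul_right (c3.mul_right c1).inv_right
      · exact (c4.mul_right c5).mul_right (c5.mul_right c4).inv_right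
    rw [h1, h2, mul_inv_rev, ← mul_assoc, mul_assoc (a * b), h3.eq, mul_inv_cancel_right]
  have hll : ⁅l, l'⁆ ∈ L := L.mul_mem (L.mul_mem (L.mul_mem hl hl') (inv_mem hl)) (inv_mem hl')
  have := mul_mem (Subgroup.mem_sup_right (S := L) key) (Subgroup.mem_sup_left (T := N) hll)
  rwa [inv_mul_cancel_right] at this

/-- A subgroup containing the `x + x^(m+1)` for `m < 8` is dense modulo every `N^m`. -/
theorem Nottingham.exists_mul_inv_mem_depth (hK : Function.Surjective (Int.cast : ℤ → K))
    {L : Subgroup (Nottingham K)} (hL : ∀ m, (hm : 2 ≤ m + 1) → m < 8 →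
      Nottingham.xAddPow K (m + 1) hm ∈ L)
    (n : ℕ) (g : Nottingham K) : ∃ l ∈ L, g * l⁻¹ ∈ Nottingham.depth K n := by
  induction n generalizing g with
  | zero => exact ⟨1, one_mem _, by rw [Nottingham.depth_zero]; trivial⟩
  | succ m ih =>
    obtain ⟨l, hl, hlg⟩ := ih g
    rcases Nat.eq_zero_or_pos m with rfl | hm0
    · exact ⟨1, one_mem _, by rw [Nottingham.depth_one]; trivial⟩
    obtain ⟨τ, hτ⟩ := hK (coeff (m + 1) ((g * l⁻¹).ser - X))
    have hlead := Nottingham.exists_hasLead hlg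
    rw [← hτ] at hlead
    -- Below depth 8 powers of the given generators have every leading coefficient. From depth 8 on,
    -- an element of [N, N] with the right leading coefficient is replaced by one of L modulo the
    -- next depth, by the induction hypothesis.
    have key : ∃ l' ∈ L, l'.HasLead m (τ : K) := by
      rcases lt_or_ge m 8 with h8 | h8
      · have h1 : (1 : ℤ) ∈ Nottingham.leads K L m := by
          refine ⟨_, hL m (by omega) h8, ?_⟩
          simp [Nottingham.HasLead, Nottingham.xAddPow_ser]
        have := zsmul_mem h1 τ
        rw [smul_eq_mul, mul_one] at this
        exact this
      · have h1 : τ ∈ Nottingham.leads K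
            ⁅(⊤ : Subgroup (Nottingham K)), (⊤ : Subgroup (Nottingham K))⁆ m := by
          rw [Nottingham.leads_commutator h8]; trivial
        obtain ⟨z, hz, hzl⟩ := h1
        have h2 := commutator_le_of_central (L := L) (M := Nottingham.depth K m)
          (N := Nottingham.depth K (m + 1))
          (fun g m hm => Nottingham.commutator_mem_depth_succ g hm) (fun g => by
            obtain ⟨l, hl, h⟩ := ih g
            exact ⟨l, hl, _, h, by group⟩) hz
        obtain ⟨l', hl', y, hy, rfl⟩ := Subgroup.mem_sup_of_normal_right.mp h2
        refine ⟨l', hl', ?_⟩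
        have hy' := (Nottingham.HasLead.inv (Nottingham.exists_hasLead
          (Nottingham.depth_antitone (Nat.le_succ m) hy)))
        rw [Nottingham.mem_depth, X_pow_dvd_iff] at hy
        rw [hy (m + 1) (by omega), neg_zero] at hy'
        simpa using hzl.mul hy'
    obtain ⟨l', hl', hlead'⟩ := key
    refine ⟨l' * l, mul_mem hl' hl, ?_⟩
    have := hlead.mul_inv_mem hlead'
    simpa [mul_assoc] using this

theorem Nottingham.isTopFinGen (hK : Function.Surjective (Int.cast : ℤ → K)) :
    IsTopFinGen (Nottingham K) := by
  let S : Set (Nottingham K) := Set.range fun m : Fin 7 =>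
    Nottingham.xAddPow K (m + 2) (by omega)
  refine ⟨S, Set.finite_range _, ?_⟩
  rw [TopGenerates, (Nottingham.isFiltration K).dense_iff]
  intro n g
  obtain ⟨l, hl, h⟩ := Nottingham.exists_mul_inv_mem_depth hK (L := Subgroup.closure S)
    (fun m hm h8 => by
      obtain ⟨j, rfl⟩ : ∃ j, m = j + 1 := ⟨m - 1, by omega⟩
      exact Subgroup.subset_closure ⟨⟨j, by omega⟩, rfl⟩) n g
  refine ⟨l, hl, ?_⟩
  have := inv_mem h
  rwa [mul_inv_rev, inv_inv] at this

theorem HSeries.comp_onePlusX_ser (g : Nottingham K) : ((onePlusX K).comp g).ser = 1 + g.ser := by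
  have h1 : (1 : K⟦X⟧).subst g.ser = 1 := by
    rw [← coe_substAlgHom g.hasSubst, map_one]
  change (1 + X : K⟦X⟧).subst g.ser = 1 + g.ser
  rw [subst_add g.hasSubst, h1, subst_X g.hasSubst]

/-- `H(K)` is generated by the series `1 + g` with `g ∈ N(K)`. -/
theorem HSeries.mem_closure (hK : Function.Surjective (Int.cast : ℤ → K)) (h : HSeries K) :
    h ∈ Subgroup.closure (Set.range fun g => (onePlusX K).comp g) := by
  have key : ∀ k : HSeries K, coeff 1 k.ser = 1 →
      k ∈ Subgroup.closure (Set.range fun g => (onePlusX K).comp g) := by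
    intro k hk
    refine Subgroup.subset_closure ⟨⟨k.ser - 1, ?_, ?_⟩, HSeries.ext ?_⟩
    · rw [map_sub, k.constCoeff_ser, map_one, sub_self]
    · rw [map_sub, hk, coeff_one, if_neg one_ne_zero, sub_zero]
    · rw [HSeries.comp_onePlusX_ser]
      exact add_sub_cancel _ _
  have hmul : ∀ a b : HSeries K, coeff 1 (a * b).ser = coeff 1 a.ser + coeff 1 b.ser := by
    intro a b
    rw [HSeries.ser_mul, coeff_one_mul, a.constCoeff_ser, b.constCoeff_ser, mul_one, mul_one]
  let φ : HSeries K →* Multiplicative K :=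
    { toFun := fun a => Multiplicative.ofAdd (coeff 1 a.ser)
      map_one' := by simp [HSeries.ser_one, coeff_one]
      map_mul' := fun a b => by rw [hmul]; rfl }
  have hX : coeff 1 (onePlusX K).ser = 1 := by simp [onePlusX, coeff_one]
  obtain ⟨n, hn⟩ := hK (1 - coeff 1 h.ser)
  have hφ : φ (onePlusX K ^ n) = Multiplicative.ofAdd (n : K) := by
    rw [map_zpow]
    change Multiplicative.ofAdd (coeff 1 (onePlusX K).ser) ^ n = _
    rw [hX, ← ofAdd_zsmul, zsmul_one]
  have hφ' : coeff 1 (onePlusX K ^ n).ser = (n : K) := Multiplicative.ofAdd.injective hφ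
  -- A power of 1 + x brings the linear coefficient of h to 1, and then the product has the form 1 +
  -- g.
  have h1 := key (onePlusX K ^ n * h) (by rw [hmul, hφ', hn]; ring)
  have h2 := mul_mem (inv_mem (zpow_mem (key (onePlusX K) hX) n)) h1
  rwa [inv_mul_cancel_left] at h2

theorem Riordan.mk_mul_mk_one (h k : HSeries K) :
    Riordan.mk (h * k) (1 : Nottingham K) = Riordan.mk h 1 * Riordan.mk k 1 := by
  rw [Riordan.mk_mul_mk, HSeries.comp_one, mul_one]

theorem Riordan.mk_mem (hK : Function.Surjective (Int.cast : ℤ → K))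
    {L : Subgroup (Riordan K)} (hL : Riordan.mk (onePlusX K) 1 ∈ L)
    (hN : ∀ g : Nottingham K, Riordan.mk 1 g ∈ L) (r : Riordan K) : r ∈ L := by
  have hH : ∀ h : HSeries K, Riordan.mk h 1 ∈ L := by
    intro h
    have hle : Subgroup.closure (Set.range fun g => (onePlusX K).comp g) ≤
        L.comap (SemidirectProduct.inl : HSeries K →* Riordan K) := by
      rw [Subgroup.closure_le]
      rintro _ ⟨g, rfl⟩
      have h1 := mul_mem (mul_mem (hN g) hL) (inv_mem (hN g))
      have h2 : Riordan.mk 1 g * Riordan.mk (onePlusX K) 1 * (Riordan.mk 1 g)⁻¹ =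
          Riordan.mk ((onePlusX K).comp g) 1 := by
        rw [mul_inv_eq_iff_eq_mul]
        simp only [Riordan.mk_mul_mk, HSeries.comp_one, one_mul, mul_one]
      rw [h2] at h1
      exact h1
    exact hle (HSeries.mem_closure hK h)
  have h1 := mul_mem (hH r.left) (hN r.right.unop)
  rw [Riordan.mk_mul_mk, HSeries.one_comp, mul_one, mul_one] at h1
  exact h1

/-- For each n, the subgroup generated by L and R^n(K) contains (1 + x, x) and, by density of the
closure of S, every (1, g). Hence it is everything by `Riordan.mk_mem`. -/
theorem Riordan.topGenerates_riordanSet (hK : Function.Surjective (Int.cast : ℤ → K))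
    {S : Set (Nottingham K)} (hS : TopGenerates S) : TopGenerates (riordanSet S) := by
  rw [TopGenerates, (Nottingham.isFiltration K).dense_iff] at hS
  rw [TopGenerates, (Riordan.isFiltration K).dense_iff]
  intro n r
  set L := Subgroup.closure (riordanSet S) with hLdef
  have hSL : Subgroup.closure S ≤ L.comap (Riordan.embN K) := by
    rw [Subgroup.closure_le]
    intro s hs
    have h1 : Riordan.embN K s⁻¹ ∈ L := by
      rw [Riordan.embN_apply, inv_inv]
      exact Subgroup.subset_closure (Or.inr ⟨s, hs, rfl⟩)
    rw [map_inv, inv_mem_iff] at h1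
    exact h1
  have hr : r ∈ L ⊔ Riordan.level K n := by
    refine Riordan.mk_mem hK (Subgroup.mem_sup_left (Subgroup.subset_closure (Or.inl rfl)))
      (fun g => ?_) r
    obtain ⟨s, hs, hsg⟩ := hS n g
    have h1 : Riordan.mk 1 s ∈ L := by
      have := hSL (inv_mem hs)
      rw [Subgroup.mem_comap, Riordan.embN_apply, inv_inv] at this
      exact this
    have h2 : Riordan.mk 1 g * (Riordan.mk 1 s)⁻¹ ∈ Riordan.level K n := by
      rw [Riordan.mul_inv_mem_level]
      refine ⟨?_, ?_⟩
      · exact mul_mem (one_mem _) (inv_mem (one_mem _))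
      · have := inv_mem hsg
        rwa [mul_inv_rev, inv_inv] at this
    have h3 := mul_mem (Subgroup.mem_sup_right (S := L) h2)
      (Subgroup.mem_sup_left (T := Riordan.level K n) h1)
    rwa [inv_mul_cancel_right] at h3
  obtain ⟨l, hl, u, hu, rfl⟩ := Subgroup.mem_sup_of_normal_right.mp hr
  refine ⟨l, hl, ?_⟩
  rw [mul_inv_rev, ← mul_assoc]
  exact (Riordan.level_normal n).conj_mem _ (inv_mem hu) l

theorem Riordan.isTopFinGen (hK : Function.Surjective (Int.cast : ℤ → K)) :
    IsTopFinGen (Riordan K) := by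
  obtain ⟨S, hS, hgen⟩ := Nottingham.isTopFinGen hK
  refine ⟨riordanSet S, (Set.finite_singleton _).union ?_, Riordan.topGenerates_riordanSet hK hgen⟩
  refine (hS.image (Riordan.mk 1)).subset ?_
  rintro _ ⟨g, hg, rfl⟩
  exact ⟨g, hg, rfl⟩

end Generation

end RiordanGroup

namespace RiordanGroup

/-! ### Solving commutator equations exactly by successive approximation. -/

section Compactness

theorem IsFiltration.continuous_hom {G H : Type*} [Group G] [TopologicalSpace G] [Group H]
    [TopologicalSpace H] {U : ℕ → Subgroup G} {V : ℕ → Subgroup H} (hU : IsFiltration U)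
    (hV : IsFiltration V) (φ : G →* H) (h : ∀ n, ∀ g ∈ U n, φ g ∈ V n) : Continuous φ := by
  refine continuous_def.mpr fun W hW => ?_
  rw [isOpen_iff_forall_mem_open]
  intro g hg
  obtain ⟨n, hn⟩ := hV.basis W hW _ hg
  refine ⟨_, fun x hx => hn _ ?_, hU.isOpen_coset n g, by simp [one_mem]⟩
  rw [← map_inv, ← map_mul]
  exact h n _ hx

variable {K : Type u} [CommRing K]

/-- If every element of `B'` is, to leading order, a commutator `⁅f, δ⁆` with `δ ∈ B` and `f` one
of two given elements, then `B'` consists of products of two such commutators. -/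
theorem Nottingham.le_commutator [Finite K] {B B' : Subgroup (Nottingham K)} {n : ℕ}
    (hB : Nottingham.depth K n ≤ B) (f : Fin 2 → Nottingham K)
    (h₁ : ∀ i, ∀ b ∈ B, ⁅f i, b⁆ ∈ B')
    (h₂ : ∀ m, ∀ z ∈ B', z ∈ Nottingham.depth K m →
      ∃ i, ∃ δ ∈ B, z * ⁅f i, δ⁆⁻¹ ∈ Nottingham.depth K (m + 1)) :
    B' ≤ ⁅B, (⊤ : Subgroup (Nottingham K))⁆ := by
  have := Nottingham.compactSpace (K := K)
  have := (Nottingham.isFiltration K).isTopologicalGroup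
  have hBc := (Nottingham.isFiltration K).isClosed_subgroup hB
  intro z hz
  have hcont : Continuous fun e : Nottingham K × Nottingham K => ⁅f 0, e.1⁆ * ⁅f 1, e.2⁆ := by
    simp only [commutatorElement_def]
    fun_prop
  obtain ⟨⟨a, b⟩, ⟨ha, hb⟩, hab⟩ := (Nottingham.isFiltration K).exists_eq (hBc.prod hBc)
    hcont z (e₀ := (1, 1)) ⟨one_mem _, one_mem _⟩
    (by rw [Nottingham.depth_zero]; trivial) (by
      rintro m ⟨a, b⟩ ⟨ha, hb⟩ hm
      simp only at ha hb hm ⊢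
      set P := ⁅f 0, a⁆ with hP
      set Q := ⁅f 1, b⁆ with hQ
      have hPB : P ∈ B' := h₁ 0 a ha
      have hQB : Q ∈ B' := h₁ 1 b hb
      have hw : (P * Q)⁻¹ * z ∈ B' := mul_mem (inv_mem (mul_mem hPB hQB)) hz
      have hwm : (P * Q)⁻¹ * z ∈ Nottingham.depth K m := by
        rw [(Nottingham.depth_normal m).mem_comm_iff]
        have := inv_mem hm
        rwa [mul_inv_rev, inv_inv] at this
      obtain ⟨i, δ, hδ, hzδ⟩ := h₂ m _ hw hwm
      let π := QuotientGroup.mk' (Nottingham.depth K (m + 1))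
      have hπ : ∀ x y, π x = π y ↔ x * y⁻¹ ∈ Nottingham.depth K (m + 1) := fun x y =>
        quotient_mk_eq_iff (Nottingham.depth_normal _)
      have hc : ∀ x, Commute (π x) (π ((P * Q)⁻¹ * z)) := fun x => by
        rw [Commute, SemiconjBy, ← map_mul, ← map_mul, hπ, ← commutatorElement_eq_mul_inv]
        exact Nottingham.commutator_mem_depth_succ x hwm
      have hδw : π ⁅f i, δ⁆ = π ((P * Q)⁻¹ * z) := ((hπ _ _).mpr hzδ).symm
      -- The correction step replaces a by aδ, or b by bδ. The new factor ⁅f i, δ⁆ agrees with the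
      -- error term, which is central modulo depth m + 1, so it can be moved past the other factors.
      have hexp : ∀ x y : Nottingham K, π ⁅x, y * δ⁆ = π ⁅x, y⁆ * (π y * π ⁅x, δ⁆ * (π y)⁻¹) := by
        intro x y
        rw [← map_inv, ← map_mul, ← map_mul, ← map_mul]
        congr 1
        simp only [commutatorElement_def]
        group
      rcases (Fin.exists_fin_two (p := fun i => π ⁅f i, δ⁆ = π ((P * Q)⁻¹ * z))).mp ⟨i, hδw⟩
        with h0 | h0
      · refine ⟨(a * δ, b), ⟨mul_mem ha hδ, hb⟩, ?_⟩
        simp only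
        rw [← hπ, map_mul, hexp, h0, (hc a).eq, mul_inv_cancel_right, mul_assoc, ← (hc _).eq,
          ← mul_assoc, ← map_mul, ← map_mul, ← hP, ← hQ, mul_inv_cancel_left]
      · refine ⟨(a, b * δ), ⟨ha, mul_mem hb hδ⟩, ?_⟩
        simp only
        rw [← hπ, map_mul, hexp, h0, (hc b).eq, mul_inv_cancel_right, ← mul_assoc,
          ← map_mul, ← map_mul, ← hP, ← hQ, mul_inv_cancel_left])
  simp only at hab
  rw [← hab, Subgroup.commutator_comm]
  exact mul_mem (Subgroup.commutator_mem_commutator trivial ha)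
    (Subgroup.commutator_mem_commutator trivial hb)

variable (K) in
/-- The homomorphism `h ↦ h(f) / h`. -/
noncomputable def HSeries.compDiv (f : Nottingham K) : HSeries K →* HSeries K where
  toFun h := h.comp f / h
  map_one' := by rw [HSeries.one_comp, div_one]
  map_mul' h k := by rw [HSeries.mul_comp, mul_div_mul_comm]

/-- The abelian counterpart of `Nottingham.le_commutator`: h ↦ h(f)/h is a continuous endomorphism
of the compact group H(K), so corrections simply multiply. -/
theorem HSeries.exists_compDiv [Finite K] {s s' : ℕ} (f : Fin 2 → Nottingham K)
    (h₁ : ∀ i, ∀ h ∈ HSeries.level K s, HSeries.compDiv K (f i) h ∈ HSeries.level K s')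
    (h₂ : ∀ m, s' ≤ m → ∀ z ∈ HSeries.level K m,
      ∃ i, ∃ δ ∈ HSeries.level K s, z / HSeries.compDiv K (f i) δ ∈ HSeries.level K (m + 1))
    {z : HSeries K} (hz : z ∈ HSeries.level K s') :
    ∃ a ∈ HSeries.level K s, ∃ b ∈ HSeries.level K s,
      HSeries.compDiv K (f 0) a * HSeries.compDiv K (f 1) b = z := by
  have := HSeries.compactSpace (K := K)
  have := (HSeries.isFiltration K).isTopologicalGroup
  have hBc := (HSeries.isFiltration K).isClosed_subgroup (le_refl (HSeries.level K s))
  have hc : ∀ i, Continuous (HSeries.compDiv K (f i)) := fun i =>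
    (HSeries.isFiltration K).continuous_hom (HSeries.isFiltration K) _ fun n g hg =>
      HSeries.level_antitone (Nat.le_succ n) (HSeries.comp_div_mem_level_succ hg _)
  have hcont : Continuous fun e : HSeries K × HSeries K =>
      HSeries.compDiv K (f 0) e.1 * HSeries.compDiv K (f 1) e.2 :=
    ((hc 0).comp continuous_fst).mul ((hc 1).comp continuous_snd)
  obtain ⟨⟨a, b⟩, ⟨ha, hb⟩, hab⟩ := (HSeries.isFiltration K).exists_eq (hBc.prod hBc)
    hcont z (e₀ := (1, 1)) ⟨one_mem _, one_mem _⟩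
    (by rw [HSeries.level_zero]; trivial) (by
      rintro m ⟨a, b⟩ ⟨ha, hb⟩ hm
      simp only at ha hb hm ⊢
      set P := HSeries.compDiv K (f 0) a with hP
      set Q := HSeries.compDiv K (f 1) b with hQ
      have hw : z / (P * Q) ∈ HSeries.level K s' := div_mem hz (mul_mem (h₁ 0 a ha) (h₁ 1 b hb))
      rcases lt_or_ge m s' with h | h
      · refine ⟨(a, b), ⟨ha, hb⟩, ?_⟩
        have := inv_mem (HSeries.level_antitone (Nat.succ_le_of_lt h) hw)
        rwa [inv_div, div_eq_mul_inv] at this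
      · have hwm : z / (P * Q) ∈ HSeries.level K m := by
          have := inv_mem hm
          rwa [← div_eq_mul_inv, inv_div] at this
        obtain ⟨i, δ, hδ, hzδ⟩ := h₂ m h _ hwm
        rcases (Fin.exists_fin_two (p := fun i => z / (P * Q) / HSeries.compDiv K (f i) δ ∈
          HSeries.level K (m + 1))).mp ⟨i, hzδ⟩ with h0 | h0
        · refine ⟨(a * δ, b), ⟨mul_mem ha hδ, hb⟩, ?_⟩
          have := inv_mem h0
          rw [inv_div, div_div_eq_mul_div] at this
          simp only
          rw [map_mul, ← div_eq_mul_inv]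
          convert this using 2
          rw [← hP, ← hQ]
          simp only [mul_comm, mul_left_comm]
        · refine ⟨(a, b * δ), ⟨ha, mul_mem hb hδ⟩, ?_⟩
          have := inv_mem h0
          rw [inv_div, div_div_eq_mul_div] at this
          simp only
          rw [map_mul, ← div_eq_mul_inv]
          convert this using 2
          rw [← hP, ← hQ]
          simp only [mul_comm, mul_left_comm])
  exact ⟨a, ha, b, hb, hab⟩

/-- The quotient by an element of `H(K)` with the same leading term. -/
theorem HSeries.div_div_mem_level {m : ℕ} (hm : 1 ≤ m) {h u w : HSeries K}
    (hh : h ∈ HSeries.level K m)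
    (huw : (X : K⟦X⟧) ^ (m + 1) ∣ u.ser - w.ser - C (coeff m (h.ser - 1)) * X ^ m) :
    h / (u / w) ∈ HSeries.level K (m + 1) := by
  set τ := coeff m (h.ser - 1) with hτ
  rw [HSeries.mem_level] at hh
  have h1 : (X : K⟦X⟧) ^ m ∣ u.ser - w.ser := by
    have := (X_pow_dvd_of_le (Nat.le_succ m) huw).add (Dvd.intro_left (C τ) rfl)
    rwa [sub_add_cancel] at this
  have h2 : (X : K⟦X⟧) ^ m ∣ (u / w).ser - 1 := HSeries.div_mem_level.mpr h1
  have h3 : (X : K⟦X⟧) ∣ w.ser - 1 := by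
    rw [X_dvd_iff, map_sub, w.constCoeff_ser, map_one, sub_self]
  have h4 : (X : K⟦X⟧) ^ (m + 1) ∣ (w.ser - 1) * ((u / w).ser - 1) := by
    rw [pow_succ']; exact mul_dvd_mul h3 h2
  have h5 : u.ser = w.ser * (u / w).ser := by
    rw [← HSeries.ser_mul, mul_div_cancel]
  have h6 : (X : K⟦X⟧) ^ (m + 1) ∣ h.ser - 1 - C τ * X ^ m := by
    rw [X_pow_dvd_iff] at hh ⊢
    intro n hn
    rcases Nat.lt_succ_iff_lt_or_eq.mp hn with h1 | rfl
    · rw [map_sub, hh n h1, coeff_C_mul, coeff_X_pow, if_neg (by omega)]; simp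
    · rw [map_sub, coeff_C_mul_X_pow, if_pos rfl, sub_self]
  rw [HSeries.div_mem_level]
  convert (h6.sub huw).add h4 using 1
  rw [h5]
  ring

/-- The element `1 + v` of `H(K)`. -/
noncomputable def HSeries.oneAdd (v : K⟦X⟧) (hv : (X : K⟦X⟧) ∣ v) : HSeries K :=
  ⟨1 + v, by rw [map_add, map_one, X_dvd_iff.mp hv, add_zero]⟩

theorem HSeries.oneAdd_ser_sub_one (v : K⟦X⟧) (hv : (X : K⟦X⟧) ∣ v) :
    (HSeries.oneAdd v hv).ser - 1 = v := add_sub_cancel_left _ _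

theorem HSeries.exists_ser_sub_one {n : ℕ} (hn : 1 ≤ n) (t : K) :
    ∃ h : HSeries K, h.ser - 1 = C t * X ^ n :=
  ⟨_, HSeries.oneAdd_ser_sub_one _ ((dvd_pow_self X (by omega)).mul_left _)⟩

theorem Nottingham.exists_ser_sub_X {n : ℕ} (hn : 2 ≤ n) (t : K) :
    ∃ g : Nottingham K, g.ser - X = C t * X ^ n :=
  ⟨_, Nottingham.addX_ser_sub_X _ ((pow_dvd_pow _ hn).mul_left _)⟩

theorem HSeries.comp_xAddPow_two_sub {n : ℕ} {t : K} {h : HSeries K}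
    (hh : h.ser - 1 = C t * X ^ n) :
    (X : K⟦X⟧) ^ (n + 2) ∣ (h.comp (Nottingham.xAddPow K 2 le_rfl)).ser - h.ser -
      C (n * t) * X ^ (n + 1) := by
  rw [HSeries.comp_sub, hh]
  have := X_pow_dvd_subst_sub (s := n) (Nottingham.xAddPow K 2 le_rfl) (w := C t * X ^ n)
    (Dvd.intro_left _ rfl)
  convert this using 2
  rw [Nottingham.xAddPow_ser]
  simp [coeff_X]
  ring

theorem HSeries.comp_xAddPow_three_sub {n : ℕ} {t : K} {h : HSeries K}
    (hh : h.ser - 1 = C t * X ^ n) :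
    (X : K⟦X⟧) ^ (n + 3) ∣ (h.comp (Nottingham.xAddPow K 3 (by omega))).ser - h.ser -
      C (n * t) * X ^ (n + 2) := by
  rw [HSeries.comp_sub, hh, subst_C_mul_X_pow, Nottingham.xAddPow_ser]
  obtain ⟨e, he⟩ := exists_one_add_pow (X ^ 2 : K⟦X⟧) n
  have hX : (X + X ^ 3 : K⟦X⟧) = X * (1 + X ^ 2) := by ring
  rw [hX, mul_pow, he, map_mul, map_natCast]
  refine ⟨C t * X * (((n.choose 2 : ℕ) : K⟦X⟧) + ((n.choose 3 : ℕ) : K⟦X⟧) * X ^ 2 + X ^ 4 * e), ?_⟩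
  ring

/-- The equation (1 + g)/(1 + x) = h is solved by g = x + (h - 1)(1 + x). -/
theorem HSeries.exists_comp_onePlusX {r : ℕ} (hr : 1 ≤ r) {h : HSeries K}
    (hh : h ∈ HSeries.level K (r + 1)) :
    ∃ g ∈ Nottingham.depth K r, (onePlusX K).comp g / onePlusX K = h := by
  have hv : (X : K⟦X⟧) ^ (r + 1) ∣ (h.ser - 1) * (1 + X) := Dvd.dvd.mul_right hh _
  refine ⟨Nottingham.addX _ (X_pow_dvd_of_le (by omega) hv), ?_, ?_⟩
  · rw [Nottingham.mem_depth, Nottingham.addX_ser_sub_X]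
    exact hv
  · rw [div_eq_iff_eq_mul]
    refine HSeries.ext ?_
    rw [HSeries.comp_onePlusX_ser]
    change 1 + (X + (h.ser - 1) * (1 + X)) = h.ser * (1 + X)
    ring

/-- An upper bound A for γ_n and a lower bound B for γ_(n+1) suffice; c is a set of coefficients
that separates the cosets of B in A. -/
theorem gammaIndex_le {G : Type u} [Group G] {n : ℕ} {A B : Subgroup G} (hA : gamma G n ≤ A)
    (hB : B ≤ gamma G (n + 1)) {T : Type*} (c : G → T)
    (h : ∀ x ∈ A, ∀ y ∈ A, c x = c y → x⁻¹ * y ∈ B) : gammaIndex G n ≤ ENat.card T :=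
  card_quotient_le (fun x : gamma G n => c x) fun x y hxy =>
    Subgroup.mem_subgroupOf.mpr (hB (h x (hA x.2) y (hA y.2) hxy))

theorem gamma_one (G : Type u) [Group G] : gamma G 1 = ⊤ := rfl

theorem gamma_succ (G : Type u) [Group G] {n : ℕ} (hn : 1 ≤ n) :
    gamma G (n + 1) = ⁅gamma G n, (⊤ : Subgroup G)⁆ := by
  obtain ⟨k, rfl⟩ := Nat.exists_eq_add_of_le' hn
  rfl

end Compactness

end RiordanGroup

namespace RiordanGroup

/-! ### The lower central series for p odd. -/

section OddCharacteristic

variable {F : Type u} [Field F]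

/-- In depth m, commuting x + x^2 with x + tx^m gives the leading coefficient t(2 - m), which is
arbitrary unless m = 2 in F. Then x + x^3 and x + tx^(m-1) give 2t, and 2 is invertible. -/
theorem Nottingham.depth_le_commutator [Finite F] (h2 : (2 : F) ≠ 0) {r r' : ℕ} (hr : 1 ≤ r)
    (hr' : (r : F) = 1 ∧ r' = r + 2 ∨ (r : F) ≠ 1 ∧ r' = r + 1) :
    Nottingham.depth F r' ≤ ⁅Nottingham.depth F r, (⊤ : Subgroup (Nottingham F))⁆ := by
  refine Nottingham.le_commutator le_rfl
    ![Nottingham.xAddPow F 2 le_rfl, Nottingham.xAddPow F 3 (by omega)] (fun i b hb => ?_)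
    (fun m z hz hzm => ?_)
  · rcases hr' with ⟨h1, rfl⟩ | ⟨h1, rfl⟩
    · exact Nottingham.commutator_mem_depth_add_two h1 hr _ hb
    · exact Nottingham.commutator_mem_depth_succ _ hb
  rcases lt_or_ge m r' with hm | hm
  · refine ⟨0, 1, one_mem _, ?_⟩
    rw [commutatorElement_one_right, inv_one, mul_one]
    exact Nottingham.depth_antitone hm hz
  have hzl := Nottingham.exists_hasLead hzm
  set τ := coeff (m + 1) (z.ser - X)
  have hmr : r + 1 ≤ m := by omega
  by_cases hm2 : (m : F) = 2
  · have hmr2 : r + 2 ≤ m := by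
      rcases hr' with ⟨h1, rfl⟩ | ⟨h1, rfl⟩
      · exact hm
      · rcases Nat.lt_or_eq_of_le hm with h | h
        · exact h
        · exfalso
          apply h1
          rw [← h] at hm2
          push_cast at hm2
          linear_combination hm2
    obtain ⟨δ, hδ⟩ := Nottingham.exists_ser_sub_X (by omega : 2 ≤ m - 1) (τ / 2)
    refine ⟨1, δ, ?_, ?_⟩
    · rw [Nottingham.mem_depth, hδ]
      exact (pow_dvd_pow _ (by omega)).mul_left _
    · have h := Nottingham.hasLead_commutator_xAddPow_three (by omega) _ hδ
      rw [show m - 1 + 1 = m by omega, Nat.cast_sub (by omega), hm2] at h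
      rw [show τ / 2 * (3 - (2 - ((1 : ℕ) : F))) = τ by push_cast; field_simp; ring] at h
      exact hzl.mul_inv_mem h
  · obtain ⟨δ, hδ⟩ := Nottingham.exists_ser_sub_X (by omega : 2 ≤ m) (τ / (2 - m))
    refine ⟨0, δ, ?_, ?_⟩
    · rw [Nottingham.mem_depth, hδ]
      exact (pow_dvd_pow _ (by omega)).mul_left _
    · have h := Nottingham.hasLead_commutator_xAddPow_two (by omega) _ hδ
      rw [div_mul_cancel₀ _ (sub_ne_zero.mpr (Ne.symm hm2))] at h
      exact hzl.mul_inv_mem h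

/-- Quotients (1 + g)/(1 + x) with g of depth r already give level r + 1 of H. For s = r - 1, level
r is reached exactly when s ≠ 0 in F, that is when r ≠ 1 in F, so the H-part and the N-part jump
together. -/
theorem Riordan.commutator_sub_depth [Finite F] (h2 : (2 : F) ≠ 0) {s r r' : ℕ}
    (hsr : s + 1 = r ∧ 2 ≤ r ∨ s = 1 ∧ r = 1)
    (hr' : (r : F) = 1 ∧ r' = r + 2 ∨ (r : F) ≠ 1 ∧ r' = r + 1) :
    ⁅Riordan.sub s (Nottingham.depth F r), (⊤ : Subgroup (Riordan F))⁆ =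
      Riordan.sub (r' - 1) (Nottingham.depth F r') := by
  have hr1 : 1 ≤ r := by omega
  apply le_antisymm
  · refine Riordan.commutator_sub_le (fun f g hg => ?_) (fun h hh f => ?_) (fun h g hg => ?_)
    · rcases hr' with ⟨h1, rfl⟩ | ⟨h1, rfl⟩
      · exact Nottingham.commutator_mem_depth_add_two h1 hr1 _ hg
      · exact Nottingham.commutator_mem_depth_succ _ hg
    · rcases hsr with ⟨rfl, _⟩ | ⟨rfl, rfl⟩
      · rcases hr' with ⟨h1, rfl⟩ | ⟨h1, rfl⟩
        · refine HSeries.comp_div_mem_level_add_two ?_ hh f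
          push_cast at h1
          linear_combination h1
        · exact HSeries.comp_div_mem_level_succ hh f
      · rcases hr' with ⟨h1, rfl⟩ | ⟨h1, rfl⟩
        · exact HSeries.comp_div_mem_level_succ hh f
        · exact absurd Nat.cast_one h1
    · exact HSeries.level_antitone (by omega)
        (HSeries.comp_div_mem_level_of_dvd h (Nottingham.mem_depth.mp hg))
  · have hbig : ∀ h ∈ HSeries.level F (r + 1), Riordan.mk h 1 ∈
        ⁅Riordan.sub s (Nottingham.depth F r), (⊤ : Subgroup (Riordan F))⁆ := by
      intro h hh
      obtain ⟨g, hg, rfl⟩ := HSeries.exists_comp_onePlusX hr1 hh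
      exact Riordan.mk_comp_div_mem_commutator' _ hg
    refine Riordan.sub_le (fun h hh => ?_)
      (fun g hg => Riordan.mk_mem_commutator (Nottingham.depth_le_commutator h2 hr1 hr' hg))
    rcases hr' with ⟨h1, rfl⟩ | ⟨h1, rfl⟩
    · exact hbig h hh
    · rcases hsr with ⟨rfl, _⟩ | ⟨rfl, rfl⟩
      · rw [Nat.add_sub_cancel] at hh
        -- Only the coefficient of x^r is missing; it is supplied by h(x + x^2)/h with h = 1 + tx^s,
        -- whose leading coefficient is st.
        have hs0 : (s : F) ≠ 0 := fun h0 => h1 (by push_cast; rw [h0, zero_add])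
        obtain ⟨k, hk⟩ := HSeries.exists_ser_sub_one (by omega : 1 ≤ s)
          (coeff (s + 1) (h.ser - 1) / (s : F))
        have h3 := HSeries.comp_xAddPow_two_sub hk
        rw [mul_div_cancel₀ _ hs0] at h3
        have h4 := hbig _ (HSeries.div_div_mem_level (by omega) hh h3)
        have hks : k ∈ HSeries.level F s := by
          rw [HSeries.mem_level, hk]; exact Dvd.intro_left _ rfl
        have h5 := Riordan.mk_comp_div_mem_commutator (B := Nottingham.depth F (s + 1)) hks
          (Nottingham.xAddPow F 2 le_rfl)
        have h6 := mul_mem h4 h5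
        rwa [← Riordan.mk_mul_mk_one, div_mul_cancel] at h6
      · exact absurd Nat.cast_one h1

theorem Riordan.exists_gamma_eq [Finite F] (h2 : (2 : F) ≠ 0) {n : ℕ} (hn : 1 ≤ n) :
    ∃ s r : ℕ, (s + 1 = r ∧ 2 ≤ r ∨ s = 1 ∧ r = 1) ∧
      gamma (Riordan F) n = Riordan.sub s (Nottingham.depth F r) := by
  induction n, hn using Nat.le_induction with
  | base =>
    refine ⟨1, 1, Or.inr ⟨rfl, rfl⟩, ?_⟩
    rw [gamma_one, eq_comm, eq_top_iff]
    intro x _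
    rw [Riordan.mem_sub, HSeries.level_one, Nottingham.depth_one]
    exact ⟨trivial, trivial⟩
  | succ n hn ih =>
    obtain ⟨s, r, hsr, ih⟩ := ih
    obtain ⟨r', hr'⟩ : ∃ r', (r : F) = 1 ∧ r' = r + 2 ∨ (r : F) ≠ 1 ∧ r' = r + 1 := by
      by_cases h : (r : F) = 1
      · exact ⟨r + 2, Or.inl ⟨h, rfl⟩⟩
      · exact ⟨r + 1, Or.inr ⟨h, rfl⟩⟩
    refine ⟨r' - 1, r', by omega, ?_⟩
    rw [gamma_succ _ hn, ih, Riordan.commutator_sub_depth h2 hsr hr']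

/-- Each filtration advances by at most two steps, so two coefficients of h and two of g determine a
coset. -/
theorem Riordan.gammaIndex_le_pow_four [Finite F] (h2 : (2 : F) ≠ 0) {n : ℕ} (hn : 1 ≤ n) :
    gammaIndex (Riordan F) n ≤ (Nat.card F : ℕ∞) ^ 4 := by
  obtain ⟨s, r, hsr, h⟩ := Riordan.exists_gamma_eq h2 hn
  obtain ⟨r', hr'⟩ : ∃ r', (r : F) = 1 ∧ r' = r + 2 ∨ (r : F) ≠ 1 ∧ r' = r + 1 := by
    by_cases h : (r : F) = 1
    · exact ⟨r + 2, Or.inl ⟨h, rfl⟩⟩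
    · exact ⟨r + 1, Or.inr ⟨h, rfl⟩⟩
  have hsucc : Riordan.sub (s + 2) (Nottingham.depth F (r + 2)) ≤ gamma (Riordan F) (n + 1) := by
    rw [gamma_succ _ hn, h, Riordan.commutator_sub_depth h2 hsr hr']
    exact Riordan.sub_mono (by omega) (Nottingham.depth_antitone (by omega))
  have hle := gammaIndex_le h.le hsucc (T := (Fin 2 → F) × (Fin 2 → F))
    (fun x => ((fun i => coeff (s + i) x.left.ser),
      (fun i => coeff (r + 1 + i) x.right.unop.ser))) (fun x hx y hy hxy => by
    rw [Prod.mk.injEq] at hxy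
    rw [Riordan.inv_mul_mem_sub, HSeries.div_mem_level, Nottingham.mul_inv_mem_depth]
    rw [Riordan.mem_sub, HSeries.mem_level, Nottingham.mem_depth] at hx hy
    refine ⟨X_pow_dvd_sub_of_coeff ?_ hxy.1, ?_⟩
    · simpa using hy.1.sub hx.1
    · rw [show r + 2 + 1 = r + 1 + 2 by ring]
      refine X_pow_dvd_sub_of_coeff ?_ hxy.2
      simpa using hy.2.sub hx.2)
  refine hle.trans (le_of_eq ?_)
  have := Fintype.ofFinite F
  rw [ENat.card_eq_coe_natCard, Nat.card_prod, Nat.card_fun, Nat.card_eq_fintype_card (α := Fin 2),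
    Fintype.card_fin]
  push_cast
  ring

end OddCharacteristic

end RiordanGroup

namespace RiordanGroup

/-! ### The lower central series in characteristic two. -/

section CharTwo

theorem X_pow_succ_dvd {K : Type u} [CommRing K] {n : ℕ} {w : K⟦X⟧}
    (h : (X : K⟦X⟧) ^ n ∣ w) (h0 : coeff n w = 0) : (X : K⟦X⟧) ^ (n + 1) ∣ w := by
  rw [X_pow_dvd_iff] at h ⊢
  intro m hm
  rcases Nat.lt_succ_iff_lt_or_eq.mp hm with h1 | rfl
  · exact h m h1
  · exact h0

variable {F : Type u} [CommRing F] [CharP F 2]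

theorem cast_eq_zero_of_even {n : ℕ} (h : Even n) : (n : F) = 0 :=
  (CharP.cast_eq_zero_iff F 2 n).mpr h.two_dvd

theorem cast_eq_one_of_odd {n : ℕ} (h : Odd n) : (n : F) = 1 := by
  obtain ⟨k, rfl⟩ := h
  rw [Nat.cast_add, cast_eq_zero_of_even (even_two_mul k), zero_add, Nat.cast_one]

theorem two_eq_zero_of_charTwo : (2 : F) = 0 := by
  simpa using cast_eq_zero_of_even (F := F) even_two

theorem derivative_derivative_eq_zero (f : F⟦X⟧) : d⁄dX F (d⁄dX F f) = 0 := by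
  ext n
  rw [coeff_derivative, coeff_derivative, mul_assoc]
  have : ((n + 1 : ℕ) + 1 : F) * (n + 1) = 0 := by
    have h := cast_eq_zero_of_even (F := F) (Nat.even_mul_succ_self (n + 1))
    rw [Nat.cast_mul, Nat.cast_succ (n + 1)] at h
    rw [mul_comm]
    exact_mod_cast h
  rw [this, mul_zero, map_zero]

/-- In characteristic two, substitution moves an even power series of order `4 j` by order 4. -/
theorem X_pow_dvd_subst_sub_of_derivative_eq_zero {j : ℕ} (f : Nottingham F) {w : F⟦X⟧}
    (hw : (X : F⟦X⟧) ^ (4 * j) ∣ w) (hw' : d⁄dX F w = 0) :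
    (X : F⟦X⟧) ^ (4 * j + 4) ∣ w.subst f.ser - w := by
  set t := coeff (4 * j) w with ht
  set w₂ := w - C t * X ^ (4 * j) with hw₂
  have h1 : (X : F⟦X⟧) ^ (4 * j + 1) ∣ w₂ :=
    X_pow_succ_dvd (hw.sub (Dvd.intro_left _ rfl)) (by
      rw [hw₂, map_sub, coeff_C_mul_X_pow, if_pos rfl, sub_self])
  have h2 : coeff (4 * j + 1) w₂ = 0 := by
    have h3 := congrArg (coeff (4 * j)) hw'
    have h4 : ((4 * j : ℕ) : F) = 0 := cast_eq_zero_of_even ⟨2 * j, by ring⟩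
    rw [coeff_derivative, h4, zero_add, mul_one, map_zero] at h3
    rw [hw₂, map_sub, coeff_C_mul_X_pow, if_neg (by omega), h3, sub_zero]
  have h3 := X_pow_dvd_subst_sub_self_of_cast_eq_zero (s := 4 * j + 2)
    (cast_eq_zero_of_even ⟨2 * j + 1, by ring⟩) f (X_pow_succ_dvd h1 h2)
  obtain ⟨e, he⟩ := X_pow_dvd_subst_sub_self f (w := X ^ j) dvd_rfl
  rw [subst_pow f.hasSubst, subst_X f.hasSubst] at he
  -- Fourth powers are additive in characteristic two, so f^(4j) - x^(4j) = (f^j - x^j)^4.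
  have h4 : (X : F⟦X⟧) ^ (4 * j + 4) ∣ C t * f.ser ^ (4 * j) - C t * X ^ (4 * j) := by
    refine ⟨C t * e ^ 4, ?_⟩
    have hF : (2 : F⟦X⟧) = 0 := by
      rw [← map_ofNat (C (R := F)) 2, two_eq_zero_of_charTwo, map_zero]
    have hf : f.ser ^ (4 * j) = (f.ser ^ j) ^ 4 := by rw [← pow_mul, mul_comm]
    have hX : (X : F⟦X⟧) ^ (4 * j) = (X ^ j) ^ 4 := by rw [← pow_mul, mul_comm]
    have hfj : f.ser ^ j = X ^ j + X ^ (j + 1) * e := by rw [← he]; ring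
    rw [hf, hX, hfj]
    linear_combination (C t * (X ^ j * (X ^ (j + 1) * e)) * (2 * (X ^ j) ^ 2 +
      3 * (X ^ j) * (X ^ (j + 1) * e) + 2 * (X ^ (j + 1) * e) ^ 2)) * hF
  have hw3 : w = w₂ + C t * X ^ (4 * j) := by rw [hw₂]; ring
  rw [hw3, subst_add f.hasSubst, subst_C_mul_X_pow]
  convert h3.add h4 using 1
  ring

variable (F) in
/-- The subgroup of `N(F)` that approximates, in characteristic two, the term `γ_k` of the lower
central series. -/
def Nottingham.gammaTwo (k : ℕ) : Subgroup (Nottingham F) := Nottingham.shape F (2 * k) (4 * k - 4)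

/-- The first order is 2k + 2 because the leading factor 1 - r vanishes for r = 2k - 1 odd. For the
derivative write g' = 1 + w; then (fg - gf)' = (f'(g) - f')(1 + w) - f'(w(f) - w). The first
difference has order at least 4k since f'' = 0, and the second gains four orders since w' = 0. -/
theorem Nottingham.commutator_mem_gammaTwo {k : ℕ} (hk : 1 ≤ k) (f : Nottingham F)
    {g : Nottingham F} (hg : g ∈ Nottingham.gammaTwo F k) :
    ⁅f, g⁆ ∈ Nottingham.gammaTwo F (k + 1) := by
  obtain ⟨j, rfl⟩ := Nat.exists_eq_add_of_le' hk
  obtain ⟨hg₁, hg₂⟩ := hg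
  rw [show 4 * (j + 1) - 4 = 4 * j by omega] at hg₂
  rw [Nottingham.gammaTwo, Nottingham.commutator_mem_shape]
  constructor
  · have h := X_pow_dvd_comp_sub_comp (r := 2 * j + 1) (by omega) f g hg₁
    have h0 : (1 : F) - ((2 * j + 1 : ℕ) : F) = 0 := by
      rw [cast_eq_one_of_odd ⟨j, rfl⟩, sub_self]
    rw [h0, zero_mul, map_zero, zero_mul, zero_mul, sub_zero] at h
    exact h
  · rw [show 4 * (j + 1 + 1) - 4 = 4 * j + 4 by omega]
    set w := d⁄dX F (g.ser - X) with hw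
    have hg' : d⁄dX F g.ser = 1 + w := by rw [hw, map_sub, derivative_X]; ring
    have t := taylor_subst (by omega) (d⁄dX F f.ser) constantCoeff_X hg₁
    rw [derivative_derivative_eq_zero, X_subst, add_sub_cancel, ← coe_substAlgHom HasSubst.X',
      map_zero, zero_mul, sub_zero] at t
    have hs := X_pow_dvd_subst_sub_of_derivative_eq_zero f hg₂ (derivative_derivative_eq_zero _)
    have h1 : (1 : F⟦X⟧).subst f.ser = 1 := by
      rw [← coe_substAlgHom f.hasSubst, map_one]
    have e : d⁄dX F ((f * g).ser - (g * f).ser) =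
        ((d⁄dX F f.ser).subst g.ser - d⁄dX F f.ser) * (1 + w) -
          d⁄dX F f.ser * (w.subst f.ser - w) := by
      rw [map_sub, Nottingham.ser_mul, Nottingham.ser_mul, derivative_subst g.hasSubst,
        derivative_subst f.hasSubst, hg', subst_add f.hasSubst, h1]
      ring
    rw [e]
    exact ((X_pow_dvd_of_le (by omega) t).mul_right _).sub (hs.mul_left _)

theorem odd_choose_two {n : ℕ} (h : n % 4 = 2 ∨ n % 4 = 3) : Odd (n.choose 2) := by
  have h2 := two_mul_choose_two n
  obtain ⟨q, hq⟩ : ∃ q, q = n / 4 := ⟨_, rfl⟩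
  rcases h with h | h
  · have hn : n = 4 * q + 2 := by omega
    have : (n.choose 2 : ℤ) = 2 * (4 * q ^ 2 + 3 * q) + 1 := by
      have hz : (n : ℤ) = 4 * q + 2 := by exact_mod_cast hn
      rw [hz] at h2
      linarith
    have : n.choose 2 = 2 * (4 * q ^ 2 + 3 * q) + 1 := by exact_mod_cast this
    exact ⟨_, this⟩
  · have hn : n = 4 * q + 3 := by omega
    have : (n.choose 2 : ℤ) = 2 * (4 * q ^ 2 + 5 * q + 1) + 1 := by
      have hz : (n : ℤ) = 4 * q + 3 := by exact_mod_cast hn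
      rw [hz] at h2
      linarith
    have : n.choose 2 = 2 * (4 * q ^ 2 + 5 * q + 1) + 1 := by exact_mod_cast this
    exact ⟨_, this⟩

theorem even_choose_three {n : ℕ} (h : Even n) : Even (n.choose 3) := by
  obtain ⟨k, rfl⟩ := h.two_dvd
  have h6 := six_mul_choose_three (2 * k)
  have h2 : (3 : ℤ) * (2 * k).choose 3 = 2 * (k * (2 * k - 1) * (k - 1)) := by
    push_cast at h6
    linarith
  have : Even ((3 : ℤ) * (2 * k).choose 3) := by rw [h2]; exact even_two_mul _
  rw [Int.even_mul] at this
  exact_mod_cast this.resolve_left (by decide)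

/-- Odd m is reached by x + x^3 and x + τx^(m-1). For even m < 4k the coefficient vanishes by the
condition on the derivative. For even m ≥ 4k the first terms of the commutators vanish and binomial
parities decide: m ≡ 2 mod 4 uses x + x^3, and m ≡ 0 mod 4 uses x + x^2 with two equal coefficients,
which cancel in the middle term. -/
theorem Nottingham.gammaTwo_le_commutator [Finite F] {k : ℕ} (hk : 2 ≤ k) :
    Nottingham.gammaTwo F (k + 1) ≤
      ⁅Nottingham.gammaTwo F k, (⊤ : Subgroup (Nottingham F))⁆ := by
  have h2F := two_eq_zero_of_charTwo (F := F)
  refine Nottingham.le_commutator (n := 4 * k) ?_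
    ![Nottingham.xAddPow F 2 le_rfl, Nottingham.xAddPow F 3 (by omega)]
    (fun i b hb => Nottingham.commutator_mem_gammaTwo (by omega) _ hb) (fun m z hz hzm => ?_)
  · intro g hg
    rw [Nottingham.mem_depth] at hg
    exact ⟨X_pow_dvd_of_le (by omega) hg, X_pow_dvd_of_le (by omega) (X_pow_dvd_derivative hg)⟩
  have htriv : z ∈ Nottingham.depth F (m + 1) → ∃ i, ∃ δ ∈ Nottingham.gammaTwo F k,
      z * ⁅(![Nottingham.xAddPow F 2 le_rfl, Nottingham.xAddPow F 3 (by omega)] :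
        Fin 2 → Nottingham F) i, δ⁆⁻¹ ∈ Nottingham.depth F (m + 1) := fun h =>
    ⟨0, 1, one_mem _, by rwa [commutatorElement_one_right, inv_one, mul_one]⟩
  rcases lt_or_ge m (2 * k + 1) with hm | hm
  · apply htriv
    rw [Nottingham.mem_depth]
    exact X_pow_dvd_of_le (by omega) hz.1
  have hzl := Nottingham.exists_hasLead hzm
  set τ := coeff (m + 1) (z.ser - X) with hτ
  rcases Nat.even_or_odd m with hme | hmo
  · rcases lt_or_ge m (4 * k) with hm4 | hm4
    · apply htriv
      have h := X_pow_dvd_iff.mp hz.2 m (by omega)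
      rw [coeff_derivative, cast_eq_zero_of_even hme, zero_add, mul_one, ← hτ] at h
      rw [h] at hzl
      exact hzl.mem_depth_succ
    have hmod : m % 4 = 2 ∨ m % 4 = 0 := by
      obtain ⟨l, rfl⟩ := hme.two_dvd
      omega
    rcases hmod with hmod | hmod
    · obtain ⟨n, rfl⟩ : ∃ n, m = n + 3 := ⟨m - 3, by omega⟩
      obtain ⟨δ, hδ⟩ := Nottingham.exists_ser_sub_X (by omega : 2 ≤ n) τ
      have hd : (X : F⟦X⟧) ^ n ∣ δ.ser - X := by rw [hδ]; exact Dvd.intro_left _ rfl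
      refine ⟨1, δ, ⟨X_pow_dvd_of_le (by omega) hd, X_pow_dvd_derivative
        (X_pow_dvd_of_le (by omega) hd)⟩, ?_⟩
      refine hzl.mul_inv_mem (Nottingham.HasLead.commutator ?_)
      have h := X_pow_dvd_xAddPow_three (n := n) (by omega) τ 0 (g := δ) (by rw [hδ]; simp)
      have hn : (n : F) = 1 := cast_eq_one_of_odd (Nat.odd_iff.mpr (by omega))
      rw [cast_eq_one_of_odd (F := F) (odd_choose_two (by omega)), hn,
        show (3 : F) - 1 = 0 by linear_combination h2F,
        show -(τ * 1) = τ by linear_combination (-τ) * h2F] at h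
      simpa using h
    · obtain ⟨n, rfl⟩ : ∃ n, m = n + 2 := ⟨m - 2, by omega⟩
      have hd : (X : F⟦X⟧) ^ n ∣ C τ * X ^ n + C τ * X ^ (n + 1) :=
        (Dvd.intro_left _ rfl).add ((pow_dvd_pow _ (by omega)).mul_left _)
      obtain ⟨δ, hδ⟩ : ∃ δ : Nottingham F, δ.ser - X = C τ * X ^ n + C τ * X ^ (n + 1) :=
        ⟨_, Nottingham.addX_ser_sub_X _ (X_pow_dvd_of_le (by omega) hd)⟩
      rw [← hδ] at hd
      refine ⟨0, δ, ⟨X_pow_dvd_of_le (by omega) hd, X_pow_dvd_derivative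
        (X_pow_dvd_of_le (by omega) hd)⟩, ?_⟩
      refine hzl.mul_inv_mem (Nottingham.HasLead.commutator ?_)
      have h := X_pow_dvd_xAddPow_two (by omega) τ τ hδ
      have hn : (n : F) = 0 := cast_eq_zero_of_even (Nat.even_iff.mpr (by omega))
      rw [cast_eq_one_of_odd (F := F) (odd_choose_two (by omega)), hn,
        cast_eq_one_of_odd (F := F) (odd_choose_two (by omega : (n + 1) % 4 = 2 ∨ (n + 1) % 4 = 3)),
        cast_eq_zero_of_even (F := F) (even_choose_three (Nat.even_iff.mpr (by omega))),
        show τ * (2 - 0) = 0 by linear_combination τ * h2F,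
        show τ * (1 - 0) - τ * 1 = 0 by ring,
        show -(τ * 0 + τ * 1) = τ by linear_combination (-τ) * h2F] at h
      simpa using h
  · obtain ⟨n, rfl⟩ : ∃ n, m = n + 1 := ⟨m - 1, by omega⟩
    have hn : (n : F) = 0 := cast_eq_zero_of_even (by
      rw [Nat.even_iff]; rw [Nat.odd_iff] at hmo; omega)
    obtain ⟨δ, hδ⟩ := Nottingham.exists_ser_sub_X (by omega : 2 ≤ n) τ
    refine ⟨1, δ, ⟨?_, ?_⟩, ?_⟩
    · rw [hδ]
      exact (pow_dvd_pow _ (by omega)).mul_left _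
    · rw [hδ, Derivation.leibniz, Derivation.leibniz_pow]
      have : ((n : ℕ) : F⟦X⟧) = 0 := by rw [← map_natCast (C (R := F)), hn, map_zero]
      simp [this]
    · have h := Nottingham.hasLead_commutator_xAddPow_three (by omega) _ hδ
      rw [hn, show τ * (3 - 0) = τ by linear_combination τ * h2F] at h
      exact hzl.mul_inv_mem h

theorem Riordan.commutator_sub_gammaTwo_le {k : ℕ} (hk : 1 ≤ k) :
    ⁅Riordan.sub (2 * k - 2) (Nottingham.gammaTwo F k), (⊤ : Subgroup (Riordan F))⁆ ≤
      Riordan.sub (2 * k) (Nottingham.gammaTwo F (k + 1)) := by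
  refine Riordan.commutator_sub_le
    (fun f g hg => Nottingham.commutator_mem_gammaTwo hk f hg) (fun h hh f => ?_)
    (fun h g hg => HSeries.comp_div_mem_level_of_dvd h hg.1)
  obtain ⟨j, rfl⟩ := Nat.exists_eq_add_of_le' hk
  exact HSeries.comp_div_mem_level_add_two (s := 2 * j) (cast_eq_zero_of_even (even_two_mul j)) hh f

/-- For the H-part, level m is reached from 1 + tx^n with n odd, so that the factor n is 1: use x +
x^2 and n = m - 1 for m even, x + x^3 and n = m - 2 for m odd. -/
theorem Riordan.sub_gammaTwo_le_commutator [Finite F] {s k : ℕ} (hs : Even s) (hs2 : 2 ≤ s)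
    (hk : 2 ≤ k) :
    Riordan.sub (s + 2) (Nottingham.gammaTwo F (k + 1)) ≤
      ⁅Riordan.sub s (Nottingham.gammaTwo F k), (⊤ : Subgroup (Riordan F))⁆ := by
  refine Riordan.sub_le (fun h hh => ?_)
    (fun g hg => Riordan.mk_mem_commutator (Nottingham.gammaTwo_le_commutator hk hg))
  obtain ⟨a, ha, b, hb, rfl⟩ := HSeries.exists_compDiv (s := s)
    ![Nottingham.xAddPow F 2 le_rfl, Nottingham.xAddPow F 3 (by omega)]
    (fun i h hh => HSeries.comp_div_mem_level_add_two (cast_eq_zero_of_even hs) hh _)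
    (fun m hm z hz => by
      rcases Nat.even_or_odd m with hme | hmo
      · obtain ⟨n, rfl⟩ : ∃ n, m = n + 1 := ⟨m - 1, by omega⟩
        have hn : (n : F) = 1 := cast_eq_one_of_odd (by
          rw [Nat.odd_iff]; rw [Nat.even_iff] at hme; omega)
        obtain ⟨δ, hδ⟩ := HSeries.exists_ser_sub_one (by omega : 1 ≤ n)
          (coeff (n + 1) (z.ser - 1))
        refine ⟨0, δ, ?_, ?_⟩
        · rw [HSeries.mem_level, hδ]
          exact (pow_dvd_pow _ (by omega)).mul_left _
        · have h := HSeries.comp_xAddPow_two_sub hδ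
          rw [hn, one_mul] at h
          exact HSeries.div_div_mem_level (by omega) hz h
      · obtain ⟨n, rfl⟩ : ∃ n, m = n + 2 := ⟨m - 2, by omega⟩
        have hn : (n : F) = 1 := cast_eq_one_of_odd (by
          rw [Nat.odd_iff] at hmo ⊢; omega)
        obtain ⟨δ, hδ⟩ := HSeries.exists_ser_sub_one (by
          rw [Nat.odd_iff] at hmo; omega : 1 ≤ n) (coeff (n + 2) (z.ser - 1))
        refine ⟨1, δ, ?_, ?_⟩
        · rw [HSeries.mem_level, hδ]
          exact (pow_dvd_pow _ (by omega)).mul_left _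
        · have h := HSeries.comp_xAddPow_three_sub hδ
          rw [hn, one_mul] at h
          exact HSeries.div_div_mem_level (by omega) hz h) hh
  rw [Riordan.mk_mul_mk_one]
  exact mul_mem (Riordan.mk_comp_div_mem_commutator ha _)
    (Riordan.mk_comp_div_mem_commutator hb _)

theorem Riordan.gamma_le_sub_gammaTwo {n : ℕ} (hn : 1 ≤ n) :
    gamma (Riordan F) n ≤ Riordan.sub (2 * n - 2) (Nottingham.gammaTwo F n) := by
  induction n, hn using Nat.le_induction with
  | base =>
    intro x _
    refine ⟨?_, ?_⟩
    · rw [HSeries.mem_level]; exact one_dvd _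
    · exact ⟨x.right.unop.X_sq_dvd, one_dvd _⟩
  | succ n hn ih =>
    rw [gamma_succ _ hn]
    exact (Subgroup.commutator_mono ih le_rfl).trans (Riordan.commutator_sub_gammaTwo_le hn)

/-- The lower bound is the upper bound of `Riordan.gamma_le_sub_gammaTwo` shifted by one, because
the reverse inclusion of commutators is available only from k = 2 and s = 2 on. -/
theorem Riordan.sub_gammaTwo_le_gamma [Finite F] {n : ℕ} (hn : 1 ≤ n) :
    Riordan.sub (2 * n) (Nottingham.gammaTwo F (n + 1)) ≤ gamma (Riordan F) n := by
  induction n, hn using Nat.le_induction with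
  | base => exact le_top
  | succ n hn ih =>
    rw [gamma_succ _ hn]
    exact (Riordan.sub_gammaTwo_le_commutator (even_two_mul n) (by omega) (by omega)).trans
      (Subgroup.commutator_mono ih le_rfl)

/-- Between the upper bound for γ_n and the lower bound for γ_(n+1) lie two steps of the chain: four
coefficients of h, four of g and eight of g'. -/
theorem Riordan.gammaIndex_le_of_charTwo [Finite F] {n : ℕ} (hn : 1 ≤ n) :
    gammaIndex (Riordan F) n ≤ (Nat.card F : ℕ∞) ^ 16 := by
  have hle := gammaIndex_le (Riordan.gamma_le_sub_gammaTwo (F := F) hn)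
    (Riordan.sub_gammaTwo_le_gamma (F := F) (by omega : 1 ≤ n + 1))
    (T := (Fin 4 → F) × (Fin 4 → F) × (Fin 8 → F))
    (fun x => ((fun i => coeff (2 * n - 2 + i) x.left.ser),
      (fun i => coeff (2 * n + i) x.right.unop.ser),
      (fun i => coeff (4 * n - 4 + i) (d⁄dX F x.right.unop.ser)))) (fun x hx y hy hxy => by
    rw [Prod.mk.injEq, Prod.mk.injEq] at hxy
    rw [Riordan.inv_mul_mem_sub, HSeries.div_mem_level, Nottingham.gammaTwo,
      Nottingham.mul_inv_mem_shape, map_sub]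
    obtain ⟨hx₁, hx₂, hx₃⟩ := hx
    obtain ⟨hy₁, hy₂, hy₃⟩ := hy
    refine ⟨?_, ?_, ?_⟩
    · rw [show 2 * (n + 1) = 2 * n - 2 + 4 by omega]
      exact X_pow_dvd_sub_of_coeff (by simpa using hy₁.sub hx₁) hxy.1
    · rw [show 2 * (n + 1 + 1) = 2 * n + 4 by omega]
      exact X_pow_dvd_sub_of_coeff (by simpa using hy₂.sub hx₂) hxy.2.1
    · rw [show 4 * (n + 1 + 1) - 4 = 4 * n - 4 + 8 by omega]
      exact X_pow_dvd_sub_of_coeff (by simpa using hy₃.sub hx₃) hxy.2.2)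
  refine hle.trans (le_of_eq ?_)
  have := Fintype.ofFinite F
  rw [ENat.card_eq_coe_natCard, Nat.card_prod, Nat.card_prod, Nat.card_fun, Nat.card_fun,
    Nat.card_eq_fintype_card (α := Fin 4), Nat.card_eq_fintype_card (α := Fin 8),
    Fintype.card_fin, Fintype.card_fin]
  push_cast
  ring

end CharTwo

/-! ### Finite width in every characteristic. -/

section Width

theorem Riordan.hasFiniteWidth (p : ℕ) [Fact p.Prime] (F : Type u) [Field F] [Finite F]
    [CharP F p] : HasFiniteWidth p (Riordan F) := by
  refine ⟨Riordan.infinite, Riordan.isProP p, ?_⟩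
  have := Fintype.ofFinite F
  obtain ⟨f, -, hf⟩ := FiniteField.card F p
  rw [← Nat.card_eq_fintype_card] at hf
  by_cases hp : p = 2
  · subst hp
    refine ⟨f * 16, fun n hn => (Riordan.gammaIndex_le_of_charTwo hn).trans (le_of_eq ?_)⟩
    rw [hf, pow_mul]
    push_cast
    rfl
  · refine ⟨f * 4, fun n hn => (Riordan.gammaIndex_le_pow_four
      (Ring.two_ne_zero (by rwa [ringChar.eq F p])) hn).trans (le_of_eq ?_)⟩
    rw [hf, pow_mul]
    push_cast
    rfl

end Width

end RiordanGroup

theorem theorem1p1 (K : Type*) [CommRing K] [Finite K] (p : ℕ) [Fact p.Prime]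
    (F : Type*) [Field F] [Finite F] [CharP F p] :
    IsProfinite (Riordan K) ∧
    IsProP p (Riordan F) ∧
    (IsTopFinGen (Riordan (ZMod p)) ∧ IsTopFinGen (Riordan ℤ) ∧
      (∀ S : Set (Nottingham (ZMod p)), TopGenerates S → TopGenerates (riordanSet S)) ∧
      (∀ S : Set (Nottingham ℤ), TopGenerates S → TopGenerates (riordanSet S))) ∧
    (HasFiniteWidth p (Riordan F) ∧
      (p ≠ 2 → ∀ n : ℕ, 1 ≤ n → gammaIndex (Riordan F) n ≤ (Nat.card F : ℕ∞) ^ 4)) := by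
  have hZ : Function.Surjective (Int.cast : ℤ → ℤ) := fun x => ⟨x, rfl⟩
  have hZp : Function.Surjective (Int.cast : ℤ → ZMod p) := ZMod.intCast_surjective
  exact ⟨Riordan.isProfinite, Riordan.isProP p,
    ⟨Riordan.isTopFinGen hZp, Riordan.isTopFinGen hZ,
      fun _ hS => Riordan.topGenerates_riordanSet hZp hS,
      fun _ hS => Riordan.topGenerates_riordanSet hZ hS⟩,
    Riordan.hasFiniteWidth p F, fun hp _ hn => Riordan.gammaIndex_le_pow_four
      (Ring.two_ne_zero (by rwa [ringChar.eq F p])) hn⟩
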